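/- **Setting.** Let $n\ge 2$, let $\Omega\subset\mathbb R^n$ be a bounded domain and $E\subset\partial\Omega$ a set of tomography. A *broken ray* is a unit speed path $\gamma:[0,L]\to\bar\Omega$, $L>0$, consisting of finitely many line segments whose relative interiors lie in $\Omega$, with both endpoints in $\bar E$, and such that at each intermediate vertex $\gamma$ meets the reflecting part $\partial\Omega\setminus\bar E$ at a point near which $\partial\Omega$ is a $C^1$ hypersurface, and is reflected there so that the angle of incidence equals the angle of reflection. The broken ray transform of $f$ is $\gamma\mapsto\int_0^L f(\gamma(t))\,dt$. $C_{pw}(\bar\Omega,\mathbb R)$ consists of the bounded Borel functions $f:\bar\Omega\to\mathbb R$ for which there are finitely many disjoint open sets $U_i\subset\Omega$ with $\bar\Omega=\bigcup_i\bar U_i$ such that every $f|_{U_i}$ extends continuously to $\bar U_i$. The broken ray transform is called *injective* on $(\Omega,E)$ if any two $f_1,f_2\in C_{pw}(\bar\Omega,\mathbb R)$ with the same broken ray transform agree almost everywhere in $\Omega$ and at all points of $\bar\Omega$ where both are continuous, and any two $f_1,f_2\in C(\bar\Omega,\mathbb R)$ with the same broken ray transform agree on $\bar\Omega$. The *cone*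 with vertex $v$, axis direction $u\neq0$ and opening angle $\alpha\in(0,2\pi]$ is $\{x\ne v:\angle(x-v,u)<\alpha/2\}$ (in the plane, an open sector of angle $\alpha$). **Proposition.** The broken ray transform is injective on $(\Omega,E)$ in the following cases. 1. $\Omega\subset\mathbb R^2$ is a bounded domain contained in a cone with opening angle $\pi/m$, $m\in\{1,2,\dots\}$, and $E\subset\partial\Omega$ is any set such that $\partial\Omega\setminus E$ lies on the boundary of the cone. For example, in polar coordinates, $\Omega=\{(r,\theta):0<\theta<\pi/m,\ 0<r<h(\theta)\}$ with $E=\{(h(\theta),\theta):0<\theta<\pi/m\}$, where $h>0$ is a bounded continuous function on $(0,\pi/m)$. 2. The same as in (1) for every real $m\ge 1/2$, that is, for every opening angle in $(0,2\pi]$. 3. $\Omega=\{(x',x)\in\mathbb R^{n-1}\times\mathbb R:|x'|<kx,\ 0<|(x',x)|<h((x',x)/|(x',x)|)\}$ and $E=\{(x',x):|x'|<kx,\ |(x',x)|=h((x',x)/|(x',x)|)\}$, where $n\ge2$, $h:S^{n-1}\to(0,\infty)$ is continuous and $k\in(0,\infty)$ is such that $\pi/(2\arctan k)\in\mathbb N$.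 4. The same as in (3) for every $k\in\mathbb R$ without the restriction (for $k=0$ the set is empty and the claim is void). Moreover, the same holds with $\{|x'|<kx\}$ replaced by a cone in $\mathbb R^n$, $n\ge2$, with vertex $0$, any axis direction and any opening angle in $(0,2\pi]$; and, for a cone in $\mathbb R^n$ with any vertex, any axis direction and any opening angle in $(0,2\pi]$, it holds for every bounded domain $\Omega$ contained in the cone and every $E\subset\partial\Omega$ such that $\partial\Omega\setminus E$ lies on the boundary of the cone. In all these cases the broken ray transform is also injective on $(\Omega',E')$ for every subdomain $\Omega'\subset\Omega$, where $E'=\partial\Omega'\setminus(\partial\Omega\setminus E)$, i.e. the part of $\partial\Omega'$ in $\partial\Omega\setminus E$ stays outside of the set of tomography. -/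

import Mathlib

open MeasureTheory Set Filter Topology

noncomputable section

namespace BrokenRayTransform

/-- Euclidean space of dimension `n`. -/
abbrev Euc (n : ℕ) : Type := EuclideanSpace ℝ (Fin n)

/-- `S` is near `p` a `C¹` hypersurface (the regular zero set of a `C¹` function `ρ`) and `ν` is one
of its two unit normals at `p`. -/
def IsUnitNormal {n : ℕ} (S : Set (Euc n)) (p ν : Euc n) : Prop :=
  ‖ν‖ = 1 ∧ ∃ (ρ : Euc n → ℝ) (c : ℝ), ContDiffAt ℝ 1 ρ p ∧ c ≠ 0 ∧
    HasGradientAt ρ (c • ν) p ∧ ρ p = 0 ∧ ∀ᶠ y in 𝓝 p, (y ∈ S ↔ ρ y = 0)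

/-- `γ : [0, L] → closure Ω` is a broken ray in the domain `Ω` with set of tomography `E ⊆ ∂Ω`:
a unit speed path that starts and ends in `closure E`, is a straight segment in `Ω` on each of the
finitely many intervals `(t j, t (j+1))`, and at each of the intermediate times hits the reflecting
part `∂Ω \ closure E` of the boundary and is reflected there, the angle of incidence being equal to
the angle of reflection. -/
def IsBrokenRay {n : ℕ} (Ω E : Set (Euc n)) (L : ℝ) (γ : ℝ → Euc n) : Prop :=
  γ 0 ∈ closure E ∧ γ L ∈ closure E ∧
  ∃ (N : ℕ) (t : Fin (N + 2) → ℝ) (v : Fin (N + 1) → Euc n),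
    StrictMono t ∧ t 0 = 0 ∧ t (Fin.last (N + 1)) = L ∧
    (∀ j : Fin (N + 1), ‖v j‖ = 1 ∧
      (∀ s ∈ Icc (t j.castSucc) (t j.succ),
        γ s = γ (t j.castSucc) + (s - t j.castSucc) • v j) ∧
      (∀ s ∈ Ioo (t j.castSucc) (t j.succ), γ s ∈ Ω)) ∧
    (∀ i : Fin N, γ (t i.succ.castSucc) ∈ frontier Ω \ closure E ∧
      ∃ ν : Euc n, IsUnitNormal (frontier Ω) (γ (t i.succ.castSucc)) ν ∧
        v i.succ = v i.castSucc - (2 * inner ℝ (v i.castSucc) ν) • ν)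

/-- The integral of `f` over the unit speed path `γ : [0, L] → closure Ω`. -/
def brt {n : ℕ} (f : Euc n → ℝ) (L : ℝ) (γ : ℝ → Euc n) : ℝ :=
  ∫ s in (0 : ℝ)..L, f (γ s)

/-- Piecewise continuous functions on `closure Ω` (values of `f` elsewhere are irrelevant): there are
finitely many disjoint open pieces in `Ω` whose closures cover `closure Ω`, and from each piece `f`
extends continuously to the closure of the piece. On the interfaces between the pieces `f` may
have any values as long as it remains bounded and Borel, so that it can be integrated along every
path. -/
def PiecewiseContinuous {n : ℕ} (Ω : Set (Euc n)) (f : Euc n → ℝ) : Prop :=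
  (∃ (N : ℕ) (U : Fin N → Set (Euc n)),
    (∀ i, IsOpen (U i)) ∧ (∀ i, U i ⊆ Ω) ∧ Pairwise (fun i j => Disjoint (U i) (U j)) ∧
    closure Ω ⊆ ⋃ i, closure (U i) ∧
    ∀ i, ∃ g : Euc n → ℝ, ContinuousOn g (closure (U i)) ∧ EqOn f g (U i)) ∧
  Measurable ((closure Ω).domRestrict f) ∧ ∃ M : ℝ, ∀ x ∈ closure Ω, |f x| ≤ M

/-- Equality of the broken ray transforms of `f₁` and `f₂`. -/
def SameBrt {n : ℕ} (Ω E : Set (Euc n)) (f₁ f₂ : Euc n → ℝ) : Prop :=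
  ∀ (L : ℝ) (γ : ℝ → Euc n), IsBrokenRay Ω E L γ → brt f₁ L γ = brt f₂ L γ

/-- The broken ray transform is injective on piecewise continuous functions on `closure Ω`, and on
continuous ones. As usual, piecewise continuous functions are identified if they differ only on
interfaces between pieces: the conclusion is equality almost everywhere in `Ω` and at every point of
`closure Ω` at which both functions are continuous. For continuous functions it is equality at every
point of `closure Ω`. -/
def BrtInjective {n : ℕ} (Ω E : Set (Euc n)) : Prop :=
  (∀ f₁ f₂ : Euc n → ℝ, PiecewiseContinuous Ω f₁ → PiecewiseContinuous Ω f₂ →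
    SameBrt Ω E f₁ f₂ →
      f₁ =ᵐ[volume.restrict Ω] f₂ ∧
      ∀ x ∈ closure Ω, ContinuousWithinAt f₁ (closure Ω) x → ContinuousWithinAt f₂ (closure Ω) x →
        f₁ x = f₂ x) ∧
  (∀ f₁ f₂ : Euc n → ℝ, ContinuousOn f₁ (closure Ω) → ContinuousOn f₂ (closure Ω) →
    SameBrt Ω E f₁ f₂ → EqOn f₁ f₂ (closure Ω))

/-- Injectivity on `Ω`, and on every subdomain `Ω'` of `Ω`, where the part of `∂Ω'` on the reflecting
part of `∂Ω` remains reflecting and the rest of `∂Ω'` is the new set of tomography. -/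
def BrtInjectiveWithSubdomains {n : ℕ} (Ω E : Set (Euc n)) : Prop :=
  BrtInjective Ω E ∧
  ∀ Ω' : Set (Euc n), IsOpen Ω' → IsConnected Ω' → Ω' ⊆ Ω →
    BrtInjective Ω' (frontier Ω' \ (frontier Ω \ E))

/-- The open circular cone with vertex `v`, axis direction `u` and opening angle `α`
(in the plane: the open sector of angle `α` with bisector `u`). For `α = 2 * π` this is the
complement of a closed half-line. -/
def openCone {n : ℕ} (v u : Euc n) (α : ℝ) : Set (Euc n) :=
  {x | x ≠ v ∧ InnerProductGeometry.angle (x - v) u < α / 2}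

/-- `Ω` is a bounded domain in the cone with vertex `v`, axis direction `u` and opening angle `α`,
and the part of the boundary outside of the set of tomography `E` lies on the cone. -/
structure IsConicalDomain {n : ℕ} (v u : Euc n) (α : ℝ) (Ω E : Set (Euc n)) : Prop where
  isOpen : IsOpen Ω
  isConnected : IsConnected Ω
  isBounded : Bornology.IsBounded Ω
  subset_cone : Ω ⊆ openCone v u α
  subset_frontier : E ⊆ frontier Ω
  frontier_diff_subset : frontier Ω \ E ⊆ frontier (openCone v u α)

/-- The point of the plane with polar coordinates `(r, θ)`. -/
def polarPoint (r θ : ℝ) : Euc 2 := !₂[r * Real.cos θ, r * Real.sin θ]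

/-- The planar domain `0 < θ < α`, `0 < r < h θ`. -/
def polarDomain (α : ℝ) (h : ℝ → ℝ) : Set (Euc 2) :=
  {x | ∃ r θ : ℝ, 0 < θ ∧ θ < α ∧ 0 < r ∧ r < h θ ∧ x = polarPoint r θ}

/-- The curve `r = h θ`, `0 < θ < α`. -/
def polarGraph (α : ℝ) (h : ℝ → ℝ) : Set (Euc 2) :=
  {x | ∃ θ : ℝ, 0 < θ ∧ θ < α ∧ x = polarPoint (h θ) θ}

/-- A set of directions `{(x', x) ∈ ℝ^d × ℝ : |x'| < k x}`. -/
def slopeCone (d : ℕ) (k : ℝ) : Set (Euc (d + 1)) :=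
  {x | ‖(WithLp.toLp 2 (fun i : Fin d => x i.castSucc) : Euc d)‖ < k * x (Fin.last d)}

/-- The part `0 < |x| < h (x / |x|)` of a cone `C` with vertex `0`. -/
def radialDomain {n : ℕ} (C : Set (Euc n)) (h : Euc n → ℝ) : Set (Euc n) :=
  {x | x ∈ C ∧ 0 < ‖x‖ ∧ ‖x‖ < h (‖x‖⁻¹ • x)}

/-- The part `|x| = h (x / |x|)` of a cone `C` with vertex `0`. -/
def radialGraph {n : ℕ} (C : Set (Euc n)) (h : Euc n → ℝ) : Set (Euc n) :=
  {x | x ∈ C ∧ 0 < ‖x‖ ∧ ‖x‖ = h (‖x‖⁻¹ • x)}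

end BrokenRayTransform

end

open BrokenRayTransform

/-
Folding the polar angle periodically into `[-α / 2, α / 2]` maps the plane onto a sector of angle
`α`, and every straight line that misses the vertex onto a path reflected by the sides of the
sector. So a difference `g` of two functions with the same broken ray transform, extended by zero,
has vanishing integrals over all folded lines, also when `π / α` is not an integer: in the angle
the unfolded function is merely periodic, not defined on a plane. Expanding in the angle, each
Fourier coefficient `A` satisfies `∫ e (arctan (t / p)) A (√(p² + t²)) dt = 0` for `p > 0`, with `e`
a character. Integrating against `p ^ N` separates the polar variables and leaves the moment
`∫ r ^ (N + 1) A r dr` times `∫ cos s ^ N e s ds`; the latter factor is asymptotically nonzero by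
Laplace's method, so almost all moments of `A` vanish and `A = 0` almost everywhere.

In higher dimensions a plane through the axis meets the cone in a sector on which rays reflect as
in the plane, so `g` vanishes on almost every such plane. For the slit cone `α = 2π` in dimension
`n ≥ 3` the boundary is too thin to be a hypersurface and lines in planes that miss it are used.
-/

namespace BrokenRayTransform

open scoped Real InnerProductSpace

/-! ### Moments and Fourier coefficients -/

section Moments

variable {F : Type*} [NormedAddCommGroup F] [NormedSpace ℝ F] {μ : Measure ℝ} {a b : ℝ} {g : ℝ → F}

theorem integrableOn_eval_smul (hg : IntegrableOn g (Icc a b) μ) (p : Polynomial ℝ) :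
    IntegrableOn (fun x => p.eval x • g x) (Icc a b) μ :=
  hg.continuousOn_smul p.continuous.continuousOn isCompact_Icc

theorem setIntegral_eval_smul_eq_zero (hg : IntegrableOn g (Icc a b) μ)
    (hmom : ∀ n : ℕ, ∫ x in Icc a b, x ^ n • g x ∂μ = 0) (p : Polynomial ℝ) :
    ∫ x in Icc a b, p.eval x • g x ∂μ = 0 := by
  have hmonomial (n : ℕ) : IntegrableOn (fun x => x ^ n • g x) (Icc a b) μ := by
    simpa using integrableOn_eval_smul hg (Polynomial.X ^ n)
  simp only [Polynomial.eval_eq_sum_range, Finset.sum_smul, mul_smul]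
  rw [integral_finsetSum _ fun n _ => (hmonomial n).fun_smul (p.coeff n)]
  simp only [integral_smul, hmom, smul_zero, Finset.sum_const_zero]

theorem ae_eq_zero_of_moments [CompleteSpace F] (hg : IntegrableOn g (Icc a b) μ)
    (hmom : ∀ n : ℕ, ∫ x in Icc a b, x ^ n • g x ∂μ = 0) :
    ∀ᵐ x ∂μ.restrict (Icc a b), g x = 0 := by
  refine ae_eq_zero_of_integral_contDiff_smul_eq_zero hg.locallyIntegrable fun φ hφ _ => ?_
  have hφg : IntegrableOn (fun x => φ x • g x) (Icc a b) μ :=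
    hg.continuousOn_smul hφ.continuous.continuousOn isCompact_Icc
  set J := ∫ x in Icc a b, ‖g x‖ ∂μ
  suffices h : ∀ ε > 0, ‖∫ x in Icc a b, φ x • g x ∂μ‖ ≤ ε * J by
    have hlim : Tendsto (fun ε : ℝ => ε * J) (𝓝[>] 0) (𝓝 0) := by
      simpa using (tendsto_id.mul_const J).mono_left (nhdsWithin_le_nhds (a := (0 : ℝ)))
    exact norm_le_zero_iff.1 <|
      ge_of_tendsto hlim (eventually_nhdsWithin_of_forall fun ε hε => h ε hε)
  intro ε hε
  obtain ⟨p, hp⟩ := exists_polynomial_near_of_continuousOn a b φ hφ.continuous.continuousOn ε hε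
  calc ‖∫ x in Icc a b, φ x • g x ∂μ‖ = ‖∫ x in Icc a b, (φ x • g x - p.eval x • g x) ∂μ‖ := by
        rw [integral_sub hφg (integrableOn_eval_smul hg p),
          setIntegral_eval_smul_eq_zero hg hmom, sub_zero]
    _ ≤ ∫ x in Icc a b, ε * ‖g x‖ ∂μ := by
        refine norm_integral_le_of_norm_le (hg.norm.const_mul ε) ?_
        filter_upwards [ae_restrict_mem measurableSet_Icc] with x hx
        rw [← sub_smul, norm_smul, Real.norm_eq_abs, abs_sub_comm]
        gcongr
        exact (hp x hx).le
    _ = ε * J := integral_const_mul _ _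

theorem ae_eq_zero_of_eventually_moments [CompleteSpace F] (hg : IntegrableOn g (Icc a b) μ)
    (hmom : ∀ᶠ n : ℕ in atTop, ∫ x in Icc a b, x ^ n • g x ∂μ = 0) :
    ∀ᵐ x ∂μ.restrict (Icc a b), x ≠ 0 → g x = 0 := by
  obtain ⟨K, hK⟩ := eventually_atTop.1 hmom
  have hpow : ∀ᵐ x ∂μ.restrict (Icc a b), x ^ K • g x = 0 := by
    refine ae_eq_zero_of_moments
      (hg.continuousOn_smul (continuous_pow K).continuousOn isCompact_Icc) fun n => ?_
    simpa only [smul_smul, ← pow_add] using hK (n + K) le_add_self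
  filter_upwards [hpow] with x hx hx0
  exact (smul_eq_zero.1 hx).resolve_left (pow_ne_zero K hx0)

end Moments

theorem ae_eq_zero_of_fourierCoeff_eq_zero {T : ℝ} [Fact (0 < T)] {f : AddCircle T → ℂ}
    (hf : MemLp f 2 AddCircle.haarAddCircle) (h0 : ∀ k, fourierCoeff f k = 0) :
    f =ᵐ[AddCircle.haarAddCircle] 0 := by
  have hLp : hf.toLp f = 0 := by
    refine fourierBasis.repr.injective (lp.ext (funext fun k => ?_))
    rw [fourierBasis_repr, fourierCoeff_congr_ae hf.coeFn_toLp, h0, map_zero]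
    rfl
  exact (MemLp.toLp_eq_toLp_iff hf MemLp.zero).1 (hLp.trans (MemLp.toLp_zero _).symm)

theorem eventually_integral_cos_pow_mul_ne_zero {e : ℝ → ℂ} (he : Continuous e) (h0 : e 0 ≠ 0) :
    ∀ᶠ N : ℕ in atTop, ∫ s in (-(π / 2))..(π / 2), (Real.cos s : ℂ) ^ N * e s ≠ 0 := by
  have hmax (s : ℝ) (hs : s ∈ Icc (-(π / 2)) (π / 2)) (hs0 : s ≠ 0) :
      Real.cos s < Real.cos 0 := by
    rw [← Real.cos_abs s]
    exact Real.cos_lt_cos_of_nonneg_of_le_pi_div_two le_rfl (abs_le.2 hs) (abs_pos.2 hs0)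
  have hpeak := tendsto_setIntegral_pow_smul_of_unique_maximum_of_isCompact_of_continuousOn
    (μ := volume) isCompact_Icc Real.continuous_cos.continuousOn hmax
    (fun s hs => Real.cos_nonneg_of_mem_Icc hs) (by simp)
    (by rw [interior_Icc, closure_Ioo (by linarith [Real.pi_pos])]
        constructor <;> linarith [Real.pi_pos])
    he.continuousOn
  filter_upwards [hpeak.eventually_ne h0] with N hN hzero
  rw [intervalIntegral.integral_of_le (by linarith [Real.pi_pos]), ← integral_Icc_eq_integral_Ioc]
    at hzero
  exact hN (by simp only [Complex.real_smul, Complex.ofReal_pow, hzero, mul_zero])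

theorem integrable_of_norm_le_of_support_subset {X F : Type*} [MeasurableSpace X]
    [NormedAddCommGroup F] {μ : Measure X} {f : X → F} (hf : AEStronglyMeasurable f μ) {M : ℝ}
    (hM : ∀ x, ‖f x‖ ≤ M) {s : Set X} (hs : μ s ≠ ⊤) (hsupp : Function.support f ⊆ s) :
    Integrable f μ :=
  (integrableOn_iff_integrable_of_support_subset hsupp).1 <|
    Measure.integrableOn_of_bounded hs hf (Eventually.of_forall hM)

/-! ### The line transform in polar coordinates -/

theorem integral_right_half_plane_polar (N : ℕ) (A e : ℝ → ℂ) :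
    ∫ x in {x : ℝ × ℝ | 0 < x.1},
      (x.1 : ℂ) ^ N * (e (Real.arctan (x.2 / x.1)) * A (√(x.1 ^ 2 + x.2 ^ 2))) =
    (∫ r in Ioi (0 : ℝ), (r : ℂ) ^ (N + 1) * A r) *
      ∫ s in (-(π / 2))..(π / 2), (Real.cos s : ℂ) ^ N * e s := by
  have hpi := Real.pi_pos
  have hsub : Ioo (-(π / 2)) (π / 2) ⊆ Ioo (-π) π := Ioo_subset_Ioo (by linarith) (by linarith)
  rw [← integral_indicator (measurableSet_lt measurable_const measurable_fst),
    ← integral_comp_polarCoord_symm, intervalIntegral.integral_of_le (by linarith),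
    integral_Ioc_eq_integral_Ioo, ← inter_eq_self_of_subset_right hsub,
    ← setIntegral_indicator measurableSet_Ioo, ← integral_prod_mul, polarCoord_target,
    Measure.prod_restrict, ← Measure.volume_eq_prod]
  refine setIntegral_congr_fun (measurableSet_Ioi.prod measurableSet_Ioo) ?_
  rintro ⟨r, s⟩ ⟨hr : 0 < r, hs : s ∈ Ioo (-π) π⟩
  simp only [polarCoord_symm_apply, indicator, mem_ofPred_eq]
  have hcos : 0 < r * Real.cos s ↔ s ∈ Ioo (-(π / 2)) (π / 2) := by
    rw [mul_pos_iff_of_pos_left hr]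
    refine ⟨fun hc => abs_lt.1 (lt_of_not_ge fun h => hc.not_ge ?_), Real.cos_pos_of_mem_Ioo⟩
    rw [← Real.cos_abs]
    exact Real.cos_nonpos_of_pi_div_two_le_of_le h (by linarith [abs_lt.2 hs])
  by_cases h : s ∈ Ioo (-(π / 2)) (π / 2)
  · have hquot : r * Real.sin s / (r * Real.cos s) = Real.tan s := by
      rw [mul_div_mul_left _ _ hr.ne', Real.tan_eq_sin_div_cos]
    have hnorm : (r * Real.cos s) ^ 2 + (r * Real.sin s) ^ 2 = r ^ 2 := by
      linear_combination r ^ 2 * Real.sin_sq_add_cos_sq s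
    rw [if_pos (hcos.2 h), if_pos h, hquot, Real.arctan_tan h.1 h.2, hnorm, Real.sqrt_sq hr.le,
      Complex.real_smul]
    push_cast
    ring
  · rw [if_neg (hcos.not.2 h), if_neg h, smul_zero, mul_zero]

section Radial

variable {A e : ℝ → ℂ} {M R : ℝ}

theorem integrableOn_right_half_plane (hA : Measurable A) (hM : ∀ r, ‖A r‖ ≤ M)
    (hR : ∀ r, R < r → A r = 0) (he : Measurable e) (he1 : ∀ s, ‖e s‖ ≤ 1) (N : ℕ) :
    IntegrableOn (fun x : ℝ × ℝ =>
      (x.1 : ℂ) ^ N * (e (Real.arctan (x.2 / x.1)) * A (√(x.1 ^ 2 + x.2 ^ 2))))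
      {x | 0 < x.1} := by
  refine Integrable.integrableOn ?_
  have hzero (x : ℝ × ℝ) (hx : R < |x.1| ∨ R < |x.2|) : A (√(x.1 ^ 2 + x.2 ^ 2)) = 0 := by
    refine hR _ (hx.elim (fun h => h.trans_le ?_) (fun h => h.trans_le ?_)) <;>
      exact Real.abs_le_sqrt (by nlinarith [sq_nonneg x.1, sq_nonneg x.2])
  refine integrable_of_norm_le_of_support_subset (s := Icc (-R) R ×ˢ Icc (-R) R)
    (M := |R| ^ N * (1 * M)) (by fun_prop) (fun x => ?_)
    (isCompact_Icc.prod isCompact_Icc).measure_lt_top.ne fun x hx => ?_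
  · have hM0 : 0 ≤ M := (norm_nonneg _).trans (hM 0)
    by_cases hx : R < |x.1|
    · rw [hzero x (.inl hx), mul_zero, mul_zero, norm_zero]
      positivity
    · rw [norm_mul, norm_mul, norm_pow, Complex.norm_real, Real.norm_eq_abs]
      have : |x.1| ≤ |R| := (not_lt.1 hx).trans (le_abs_self R)
      gcongr
      exacts [he1 _, hM _]
  · by_contra h
    refine hx ?_
    dsimp only
    rw [hzero x ?_, mul_zero, mul_zero]
    simpa only [mem_prod, mem_Icc, ← abs_le, not_and_or, not_le] using h

theorem radial_moment_mul_integral_cos_pow_eq_zero (hA : Measurable A) (hM : ∀ r, ‖A r‖ ≤ M)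
    (hR : ∀ r, R < r → A r = 0) (he : Measurable e) (he1 : ∀ s, ‖e s‖ ≤ 1)
    (hline : ∀ p, 0 < p → ∫ t, e (Real.arctan (t / p)) * A (√(p ^ 2 + t ^ 2)) = 0) (N : ℕ) :
    (∫ r in Ioi (0 : ℝ), (r : ℂ) ^ (N + 1) * A r) *
      ∫ s in (-(π / 2))..(π / 2), (Real.cos s : ℂ) ^ N * e s = 0 := by
  have hset : {x : ℝ × ℝ | 0 < x.1} = Ioi (0 : ℝ) ×ˢ univ := by ext; simp
  have hint := integrableOn_right_half_plane hA hM hR he he1 N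
  rw [← integral_right_half_plane_polar, hset, Measure.volume_eq_prod, setIntegral_prod _
    (by rwa [← hset, ← Measure.volume_eq_prod])]
  refine setIntegral_eq_zero_of_forall_eq_zero fun p hp => ?_
  simp only [Measure.restrict_univ]
  rw [integral_const_mul, hline p hp, mul_zero]

theorem ae_eq_zero_of_weighted_line_integrals (hA : Measurable A) (hM : ∀ r, ‖A r‖ ≤ M)
    (hR : ∀ r, R < r → A r = 0) (he : Continuous e) (he1 : ∀ s, ‖e s‖ ≤ 1) (he0 : e 0 ≠ 0)
    (hline : ∀ p, 0 < p → ∫ t, e (Real.arctan (t / p)) * A (√(p ^ 2 + t ^ 2)) = 0) :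
    ∀ᵐ r, 0 < r → A r = 0 := by
  have hint : IntegrableOn (fun r : ℝ => r • A r) (Icc 0 R) :=
    (Measure.integrableOn_of_bounded measure_Icc_lt_top.ne hA.aestronglyMeasurable
      (Eventually.of_forall hM)).continuousOn_smul continuousOn_id isCompact_Icc
  have hmom : ∀ᶠ N : ℕ in atTop, ∫ r in Icc 0 R, r ^ N • (r • A r) = 0 := by
    filter_upwards [eventually_integral_cos_pow_mul_ne_zero he he0] with N hN
    have h := (mul_eq_zero.1 <| radial_moment_mul_integral_cos_pow_eq_zero
      hA hM hR he.measurable he1 hline N).resolve_right hN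
    rw [integral_Icc_eq_integral_Ioc, ← h, ← setIntegral_eq_of_subset_of_forall_sdiff_eq_zero
      measurableSet_Ioi Ioc_subset_Ioi_self fun r hr => ?_]
    · simp only [Complex.real_smul, Complex.ofReal_pow, pow_succ, mul_assoc]
    · rw [hR r (lt_of_not_ge fun h => hr.2 ⟨hr.1, h⟩), smul_zero, smul_zero]
  have hae := ae_eq_zero_of_eventually_moments hint hmom
  rw [ae_restrict_iff' measurableSet_Icc] at hae
  filter_upwards [hae] with r hr hr0
  rcases le_or_gt r R with h | h
  · exact (smul_eq_zero.1 (hr ⟨hr0.le, h⟩ hr0.ne')).resolve_left hr0.ne'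
  · exact hR r h

end Radial

section Angular

variable {T : ℝ} [hT : Fact (0 < T)]

theorem fourierCoeff_comp_add_right (f : AddCircle T → ℂ) (c : AddCircle T) (k : ℤ) :
    fourierCoeff (fun y => f (y + c)) k = fourier k c * fourierCoeff f k := by
  have hfourier (y : AddCircle T) : fourier (-k) y = fourier k c * fourier (-k) (y + c) := by
    simp only [fourier_apply, smul_add, AddCircle.toCircle_add, neg_smul, AddCircle.toCircle_neg,
      Circle.coe_mul]
    rw [mul_left_comm, ← Circle.coe_mul, mul_inv_cancel, Circle.coe_one, mul_one]
  simp only [fourierCoeff]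
  rw [← integral_const_mul,
    ← integral_add_right_eq_self (fun y => fourier k c * (fourier (-k) y • f y)) c]
  refine integral_congr_ae (.of_forall fun y => ?_)
  simp only [hfourier y, smul_eq_mul, mul_assoc]

variable {F : ℝ → AddCircle T → ℂ} {M R : ℝ}

theorem integral_fourier_mul_fourierCoeff_eq_zero (hF : Measurable (Function.uncurry F))
    (hM : ∀ r y, ‖F r y‖ ≤ M) (hR : ∀ r y, R < r → F r y = 0) {p : ℝ}
    (hline : ∀ φ, ∫ t, F (√(p ^ 2 + t ^ 2)) (φ + (Real.arctan (t / p) : ℝ)) = 0) (k : ℤ) :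
    ∫ t, fourier k (Real.arctan (t / p) : AddCircle T) * fourierCoeff (F (√(p ^ 2 + t ^ 2))) k
      = 0 := by
  have hint : Integrable (fun x : ℝ × AddCircle T => fourier (-k) x.2 •
      F (√(p ^ 2 + x.1 ^ 2)) (x.2 + (Real.arctan (x.1 / p) : ℝ)))
      (volume.prod AddCircle.haarAddCircle) := by
    refine integrable_of_norm_le_of_support_subset (M := 1 * M) (s := Icc (-R) R ×ˢ univ) ?_
      (fun x => ?_) ?_ fun x hx => ⟨?_, mem_univ _⟩
    · have hdir : Measurable fun x : ℝ × AddCircle T =>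
          (√(p ^ 2 + x.1 ^ 2), x.2 + ((Real.arctan (x.1 / p) : ℝ) : AddCircle T)) := by
        have := AddCircle.measurable_mk' (a := T)
        fun_prop
      have := hF.comp hdir
      exact (((fourier (-k)).continuous.measurable.comp measurable_snd).smul
        this).aestronglyMeasurable
    · rw [norm_smul]
      gcongr
      · exact ((fourier (-k)).norm_coe_le_norm x.2).trans_eq (fourier_norm (-k))
      · exact hM _ _
    · rw [Measure.prod_prod, measure_univ, mul_one]
      exact measure_Icc_lt_top.ne
    · refine abs_le.1 (le_of_not_gt fun h => hx ?_)
      have : R < √(p ^ 2 + x.1 ^ 2) := h.trans_le (Real.abs_le_sqrt (by nlinarith [sq_nonneg p]))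
      dsimp only
      rw [hR _ _ this, smul_zero]
  simp only [← fourierCoeff_comp_add_right]
  simp only [fourierCoeff]
  rw [integral_integral_swap hint]
  simp only [integral_smul, hline, smul_zero, integral_zero]

theorem ae_eq_zero_of_polar_line_integrals (hF : Measurable (Function.uncurry F))
    (hM : ∀ r y, ‖F r y‖ ≤ M) (hR : ∀ r y, R < r → F r y = 0)
    (hline : ∀ p, 0 < p → ∀ φ,
      ∫ t, F (√(p ^ 2 + t ^ 2)) (φ + (Real.arctan (t / p) : ℝ)) = 0) :
    ∀ᵐ r, 0 < r → F r =ᵐ[AddCircle.haarAddCircle] 0 := by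
  have hcoeff (k : ℤ) : ∀ᵐ r, 0 < r → fourierCoeff (F r) k = 0 := by
    have hnorm (y : AddCircle T) (k : ℤ) : ‖fourier k y‖ ≤ 1 :=
      ((fourier k).norm_coe_le_norm y).trans_eq (fourier_norm k)
    refine ae_eq_zero_of_weighted_line_integrals (M := M) (R := R)
      (e := fun s => fourier k (s : AddCircle T)) ?_ (fun r => ?_) (fun r hr => ?_)
      ((fourier k).continuous.comp (AddCircle.continuous_mk' T)) (fun s => hnorm _ k)
      (by simp) fun p hp =>
        integral_fourier_mul_fourierCoeff_eq_zero hF hM hR (hline p hp) k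
    · have hmeas : StronglyMeasurable (Function.uncurry fun r y => fourier (-k) y • F r y) :=
        (((fourier (-k)).continuous.measurable.comp measurable_snd).smul hF).stronglyMeasurable
      exact hmeas.integral_prod_right.measurable
    · refine (norm_integral_le_of_norm_le_const (C := 1 * M) (.of_forall fun y => ?_)).trans_eq
        (by simp)
      rw [norm_smul]
      gcongr
      exacts [hnorm y _, hM r y]
    · simp only [fourierCoeff, hR r _ hr, smul_zero, integral_zero]
  filter_upwards [ae_all_iff.2 hcoeff] with r hr hr0
  exact ae_eq_zero_of_fourierCoeff_eq_zero
    (.of_bound (hF.comp measurable_prodMk_left).aestronglyMeasurable M (.of_forall (hM r)))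
    fun k => hr k hr0

end Angular

/-! ### Reflected paths and their excursions into the domain -/

theorem exists_strictMono_partition {B : Set ℝ} (hB : B.Finite) {a b : ℝ} (hab : a < b) :
    ∃ (N : ℕ) (t : Fin (N + 2) → ℝ), StrictMono t ∧ t 0 = a ∧ t (Fin.last (N + 1)) = b ∧
      (∀ j : Fin (N + 1), ∀ s ∈ Ioo (t j.castSucc) (t j.succ), s ∉ B) ∧
      ∀ i : Fin N, t i.succ.castSucc ∈ B := by
  classical
  let K : Finset ℝ := hB.toFinset.filter (· ∈ Ioo a b)
  have hK (x : ℝ) : x ∈ K ↔ x ∈ B ∧ x ∈ Ioo a b := by simp [K]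
  let S : Finset ℝ := insert a (insert b K)
  have hS (x : ℝ) : x ∈ S ↔ x = a ∨ x = b ∨ x ∈ B ∧ x ∈ Ioo a b := by
    simp only [S, Finset.mem_insert, hK]
  have hcard : S.card = K.card + 2 := by
    rw [Finset.card_insert_of_notMem, Finset.card_insert_of_notMem]
    · simp [hK]
    · simp [hK, hab.ne]
  let t := S.orderEmbOfFin hcard
  have ht_mem (i) : t i ∈ S := Finset.orderEmbOfFin_mem S hcard i
  have hSab {x : ℝ} (hx : x ∈ S) : x ∈ Icc a b := by
    rcases (hS x).1 hx with rfl | rfl | ⟨-, h⟩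
    exacts [left_mem_Icc.2 hab.le, right_mem_Icc.2 hab.le, Ioo_subset_Icc_self h]
  have ht_surj {x : ℝ} (hx : x ∈ S) : ∃ i, t i = x := by
    rw [← mem_range, Finset.range_orderEmbOfFin]
    exact hx
  have ht0 : t 0 = a := by
    obtain ⟨i, hi⟩ := ht_surj ((hS a).2 (.inl rfl))
    exact le_antisymm (hi ▸ t.monotone (Fin.zero_le i)) (hSab (ht_mem 0)).1
  have htlast : t (Fin.last _) = b := by
    obtain ⟨i, hi⟩ := ht_surj ((hS b).2 (.inr (.inl rfl)))
    exact le_antisymm (hSab (ht_mem _)).2 (hi ▸ t.monotone (Fin.le_last i))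
  refine ⟨K.card, t, t.strictMono, ht0, htlast, fun j s hs hsB => ?_, fun i => ?_⟩
  · have hsab : s ∈ Ioo a b :=
      ⟨(hSab (ht_mem _)).1.trans_lt hs.1, hs.2.trans_le (hSab (ht_mem _)).2⟩
    obtain ⟨i, rfl⟩ := ht_surj ((hS s).2 (.inr (.inr ⟨hsB, hsab⟩)))
    exact (t.lt_iff_lt.1 hs.1).not_ge (Fin.le_castSucc_iff.2 (t.lt_iff_lt.1 hs.2))
  · refine (((hS _).1 (ht_mem i.succ.castSucc)).resolve_left ?_ |>.resolve_left ?_).1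
    · exact ht0 ▸ (t.strictMono (Fin.castSucc_pos (Fin.succ_pos i))).ne'
    · exact htlast ▸ (t.strictMono (Fin.castSucc_lt_last _)).ne

theorem velocity_unique {V : Type*} [AddCommGroup V] [Module ℝ V] {σ : ℝ → V}
    {t : ℝ} {v w : V} {l : Filter ℝ} [l.NeBot] (hl : l ≤ 𝓝[≠] t)
    (hv : ∀ᶠ s in l, σ s = σ t + (s - t) • v) (hw : ∀ᶠ s in l, σ s = σ t + (s - t) • w) :
    v = w := by
  obtain ⟨s, ⟨hsv, hsw⟩, hst⟩ := ((hv.and hw).and (hl self_mem_nhdsWithin)).exists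
  exact smul_right_injective V (sub_ne_zero.2 hst) (add_left_cancel (hsv.symm.trans hsw))

/-- A path on the whole real line whose excursions into `Ω` are broken rays. The kinks of the path
are among the finitely many times in `B`; at a kink the path is outside of `Ω`, and either in
`closure E`, or off the boundary, or reflected with `Ω` on both sides of the kink as soon as it
accumulates there. -/
structure IsReflectedPath {n : ℕ} (Ω E : Set (Euc n)) (σ : ℝ → Euc n) (B : Set ℝ) : Prop where
  continuous : Continuous σ
  finite : B.Finite
  segment : ∀ x y, x < y → (∀ t ∈ Ioo x y, t ∉ B) →
    ∃ V : Euc n, ‖V‖ = 1 ∧ ∀ s ∈ Icc x y, σ s = σ x + (s - x) • V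
  notMem : ∀ t ∈ B, σ t ∉ Ω
  tomography : ∀ t, t ∉ B → σ t ∈ frontier Ω → σ t ∈ closure E
  inside : ∀ t ∈ B, σ t ∈ frontier Ω \ closure E →
    (∃ᶠ s in 𝓝[≠] t, σ s ∈ Ω) → ∀ᶠ s in 𝓝[≠] t, σ s ∈ Ω
  reflect : ∀ t ∈ B, σ t ∈ frontier Ω \ closure E →
    ∃ ν V W : Euc n, IsUnitNormal (frontier Ω) (σ t) ν ∧ W = V - (2 * inner ℝ V ν) • ν ∧
      (∀ᶠ s in 𝓝[<] t, σ s = σ t + (s - t) • V) ∧ (∀ᶠ s in 𝓝[>] t, σ s = σ t + (s - t) • W)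
  bounded : ∃ R, ∀ t, σ t ∈ Ω → |t| ≤ R

/-- The times at which a path is inside `Ω`, together with the isolated times at which it touches
the reflecting part of the boundary. -/
def excursionTimes {n : ℕ} (Ω E : Set (Euc n)) (σ : ℝ → Euc n) : Set ℝ :=
  {t | (∀ᶠ s in 𝓝[≠] t, σ s ∈ Ω) ∧ (σ t ∈ Ω ∨ σ t ∉ closure E)}

section Excursions

variable {n : ℕ} {Ω E : Set (Euc n)} {σ : ℝ → Euc n} {B : Set ℝ}

theorem mem_excursionTimes_of_mem (hσ : Continuous σ) (hΩ : IsOpen Ω) {t : ℝ} (ht : σ t ∈ Ω) :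
    t ∈ excursionTimes Ω E σ :=
  ⟨nhdsWithin_le_nhds (hσ.continuousAt.eventually (hΩ.mem_nhds ht)), .inl ht⟩

theorem isOpen_excursionTimes (hσ : Continuous σ) (hΩ : IsOpen Ω) :
    IsOpen (excursionTimes Ω E σ) := by
  refine isOpen_iff_mem_nhds.2 fun t ht => ?_
  filter_upwards [eventually_nhdsWithin_iff.1 ht.1] with s hs
  by_cases hst : s = t
  exacts [hst ▸ ht, mem_excursionTimes_of_mem hσ hΩ (hs hst)]

theorem mem_closure_of_mem_excursionTimes (hσ : Continuous σ) {t : ℝ}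
    (ht : t ∈ excursionTimes Ω E σ) : σ t ∈ closure Ω :=
  mem_closure_of_tendsto (hσ.continuousAt.tendsto.mono_left nhdsWithin_le_nhds) ht.1

theorem IsReflectedPath.mem_or_mem_kinks (h : IsReflectedPath Ω E σ B) (hΩ : IsOpen Ω) {t : ℝ}
    (ht : t ∈ excursionTimes Ω E σ) : σ t ∈ Ω ∨ t ∈ B ∧ σ t ∈ frontier Ω \ closure E := by
  by_cases hin : σ t ∈ Ω
  · exact .inl hin
  have hE := ht.2.resolve_left hin
  have hfr : σ t ∈ frontier Ω :=
    hΩ.frontier_eq ▸ ⟨mem_closure_of_mem_excursionTimes h.continuous ht, hin⟩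
  exact .inr ⟨not_not.1 fun hB => hE (h.tomography t hB hfr), hfr, hE⟩

theorem IsReflectedPath.mem_closure_of_frequently (h : IsReflectedPath Ω E σ B) (hΩ : IsOpen Ω)
    {t : ℝ} (ht : t ∉ excursionTimes Ω E σ) (hfreq : ∃ᶠ s in 𝓝[≠] t, s ∈ excursionTimes Ω E σ) :
    σ t ∈ closure E := by
  by_contra hE
  have hcl : σ t ∈ closure Ω := closure_closure (s := Ω) ▸
    mem_closure_of_frequently_of_tendsto
      (hfreq.mono fun _ => mem_closure_of_mem_excursionTimes h.continuous)
      (h.continuous.continuousAt.tendsto.mono_left nhdsWithin_le_nhds)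
  have hfr : σ t ∈ frontier Ω :=
    hΩ.frontier_eq ▸ ⟨hcl, fun hin => ht (mem_excursionTimes_of_mem h.continuous hΩ hin)⟩
  have hB : t ∈ B := not_not.1 fun hB => hE (h.tomography t hB hfr)
  have hkink : ∀ᶠ s in 𝓝[≠] t, s ∉ B :=
    nhdsNE_le_cofinite t h.finite.eventually_cofinite_notMem
  refine ht ⟨h.inside t hB ⟨hfr, hE⟩ ((hfreq.and_eventually hkink).mono fun s hs => ?_), .inr hE⟩
  exact (h.mem_or_mem_kinks hΩ hs.1).resolve_right fun hs' => hs.2 hs'.1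

theorem IsReflectedPath.isBrokenRay (h : IsReflectedPath Ω E σ B) {a b : ℝ} (hab : a < b)
    (hin : ∀ t ∈ Ioo a b, σ t ∈ Ω ∨ t ∈ B ∧ σ t ∈ frontier Ω \ closure E)
    (ha : σ a ∈ closure E) (hb : σ b ∈ closure E) :
    IsBrokenRay Ω E (b - a) fun s => σ (a + s) := by
  obtain ⟨N, t, hmono, rfl, rfl, hgap, hkink⟩ := exists_strictMono_partition h.finite hab
  have hlt (j : Fin (N + 1)) : t j.castSucc < t j.succ := hmono Fin.castSucc_lt_succ
  choose v hnorm hseg using fun j => h.segment _ _ (hlt j) (hgap j)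
  refine ⟨by simpa using ha, by simpa using hb, N, fun j => t j - t 0, v,
    fun i j hij => sub_lt_sub_right (hmono hij) _, sub_self _, rfl,
    fun j => ⟨hnorm j, fun s hs => ?_, fun s hs => ?_⟩, fun i => ?_⟩
  · simp only [add_sub_cancel]
    rw [hseg j (t 0 + s) ⟨by linarith [hs.1], by linarith [hs.2]⟩, sub_sub_eq_add_sub, add_comm s]
  · have hsj : t 0 + s ∈ Ioo (t j.castSucc) (t j.succ) :=
      ⟨by linarith [hs.1], by linarith [hs.2]⟩
    have hsab : t 0 + s ∈ Ioo (t 0) (t (Fin.last _)) :=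
      ⟨(hmono.monotone (Fin.zero_le _)).trans_lt hsj.1,
        hsj.2.trans_le (hmono.monotone (Fin.le_last _))⟩
    exact (hin _ hsab).resolve_right fun hB => hgap j _ hsj hB.1
  · simp only [add_sub_cancel]
    set q := t i.succ.castSucc
    have hleft : t i.castSucc.castSucc < q := hlt i.castSucc
    have hright : q < t i.succ.succ := hlt i.succ
    have hfr : σ q ∈ frontier Ω \ closure E := by
      refine ((hin q ⟨?_, ?_⟩).resolve_left (h.notMem q (hkink i))).2
      · exact hmono (Fin.castSucc_pos (Fin.succ_pos i))
      · exact hmono (Fin.castSucc_lt_last _)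
    obtain ⟨ν, V, W, hν, rfl, hV, hW⟩ := h.reflect q (hkink i) hfr
    have hbefore : ∀ᶠ s in 𝓝[<] q, σ s = σ q + (s - q) • v i.castSucc := by
      filter_upwards [Ioo_mem_nhdsLT hleft] with s hs
      rw [hseg i.castSucc s (Ioo_subset_Icc_self hs),
        hseg i.castSucc q (right_mem_Icc.2 hleft.le), add_assoc, ← add_smul]
      congr 2
      ring
    have hafter : ∀ᶠ s in 𝓝[>] q, σ s = σ q + (s - q) • v i.succ :=
      eventually_of_mem (Ioo_mem_nhdsGT hright) fun s hs => hseg i.succ s (Ioo_subset_Icc_self hs)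
    refine ⟨hfr, ν, hν, ?_⟩
    rw [velocity_unique (nhdsLT_le_nhdsNE q) hbefore hV,
      velocity_unique (nhdsGT_le_nhdsNE q) hafter hW]

end Excursions

/-! ### Integrals over reflected paths -/

theorem exists_Ioo_subset_notMem {U : Set ℝ} (hU : IsOpen U) (hbdd : Bornology.IsBounded U)
    {x : ℝ} (hx : x ∈ U) : ∃ a b, x ∈ Ioo a b ∧ Ioo a b ⊆ U ∧ a ∉ U ∧ b ∉ U := by
  obtain ⟨R, hR⟩ := hbdd.subset_closedBall x
  have hout (y : ℝ) (hy : R < |y - x|) : y ∉ U := fun h => hy.not_ge (hR h)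
  have hR1 : R < |R| + 1 := (le_abs_self R).trans_lt (lt_add_one _)
  let below := Iic x ∩ Uᶜ
  let above := Ici x ∩ Uᶜ
  have hbelow : below.Nonempty :=
    ⟨x - (|R| + 1), by simp only [mem_Iic]; linarith [abs_nonneg R],
      hout _ (by rwa [sub_sub_cancel_left, abs_neg, abs_of_pos (by positivity)])⟩
  have habove : above.Nonempty :=
    ⟨x + (|R| + 1), by simp only [mem_Ici]; linarith [abs_nonneg R],
      hout _ (by rwa [add_sub_cancel_left, abs_of_pos (by positivity)])⟩
  have hbelow_bdd : BddAbove below := ⟨x, fun y hy => hy.1⟩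
  have habove_bdd : BddBelow above := ⟨x, fun y hy => hy.1⟩
  have ha := (isClosed_Iic.inter hU.isClosed_compl).csSup_mem hbelow hbelow_bdd
  have hb := (isClosed_Ici.inter hU.isClosed_compl).csInf_mem habove habove_bdd
  refine ⟨sSup below, sInf above, ⟨lt_of_le_of_ne ha.1 (ne_of_mem_of_not_mem hx ha.2).symm,
    lt_of_le_of_ne hb.1 (ne_of_mem_of_not_mem hx hb.2)⟩, fun y hy => ?_, ha.2, hb.2⟩
  by_contra hyU
  rcases le_total y x with h | h
  · exact (le_csSup hbelow_bdd ⟨h, hyU⟩).not_gt hy.1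
  · exact (csInf_le habove_bdd ⟨h, hyU⟩).not_gt hy.2

theorem pairwiseDisjoint_Ioo_of_notMem (U : Set ℝ) :
    {c : ℝ × ℝ | Ioo c.1 c.2 ⊆ U ∧ c.1 ∉ U ∧ c.2 ∉ U}.PairwiseDisjoint fun c => Ioo c.1 c.2 := by
  have hle {a b c d x : ℝ} (hab : Ioo a b ⊆ U) (hc : c ∉ U) (hd : d ∉ U) (hx : x ∈ Ioo a b)
      (hx' : x ∈ Ioo c d) : c ≤ a ∧ b ≤ d :=
    ⟨not_lt.1 fun h => hc (hab ⟨h, hx'.1.trans hx.2⟩),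
      not_lt.1 fun h => hd (hab ⟨hx.1.trans hx'.2, h⟩)⟩
  rintro ⟨a, b⟩ ⟨hab, ha, hb⟩ ⟨c, d⟩ ⟨hcd, hc, hd⟩ hne
  refine Set.disjoint_left.2 fun x hx hx' => hne ?_
  obtain ⟨hca, hbd⟩ := hle hab hc hd hx hx'
  obtain ⟨hac, hdb⟩ := hle hcd ha hb hx' hx
  exact Prod.ext (le_antisymm hac hca) (le_antisymm hbd hdb)

theorem setIntegral_eq_zero_of_forall_Ioo {F : Type*} [NormedAddCommGroup F] [NormedSpace ℝ F]
    {μ : Measure ℝ} {U : Set ℝ} (hU : IsOpen U) (hbdd : Bornology.IsBounded U) {f : ℝ → F}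
    (hf : IntegrableOn f U μ)
    (h0 : ∀ a b, a < b → Ioo a b ⊆ U → a ∉ U → b ∉ U → ∫ t in Ioo a b, f t ∂μ = 0) :
    ∫ t in U, f t ∂μ = 0 := by
  let I : Set (ℝ × ℝ) := {c | c.1 < c.2 ∧ Ioo c.1 c.2 ⊆ U ∧ c.1 ∉ U ∧ c.2 ∉ U}
  have hdisj : I.PairwiseDisjoint fun c => Ioo c.1 c.2 :=
    (pairwiseDisjoint_Ioo_of_notMem U).subset fun _ => And.right
  have hunion : U = ⋃ c : ↥I, Ioo c.1.1 c.1.2 := by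
    refine Subset.antisymm (fun x hx => ?_) (iUnion_subset fun c => c.2.2.1)
    obtain ⟨a, b, hxab, hsub⟩ := exists_Ioo_subset_notMem hU hbdd hx
    exact mem_iUnion.2 ⟨⟨(a, b), hxab.1.trans hxab.2, hsub⟩, hxab⟩
  have : Countable I := (hdisj.countable_of_isOpen (fun _ _ => isOpen_Ioo)
    fun c hc => nonempty_Ioo.2 hc.1).to_subtype
  rw [hunion] at hf
  rw [hunion, integral_iUnion (fun _ => measurableSet_Ioo)
    (fun (c d : I) hcd => hdisj c.2 d.2 (Subtype.coe_injective.ne hcd)) hf]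
  exact (tsum_congr fun c => h0 _ _ c.2.1 c.2.2.1 c.2.2.2.1 c.2.2.2.2).trans tsum_zero

section PathIntegrals

variable {n : ℕ} {Ω E : Set (Euc n)} {σ : ℝ → Euc n} {B : Set ℝ} {f₁ f₂ : Euc n → ℝ}

theorem IsReflectedPath.isBounded_excursionTimes (h : IsReflectedPath Ω E σ B) :
    Bornology.IsBounded (excursionTimes Ω E σ) := by
  obtain ⟨R, hR⟩ := h.bounded
  refine (Metric.isBounded_Icc (-R) R).subset fun t ht => abs_le.1 ?_
  exact le_of_tendsto (continuous_abs.continuousAt.tendsto.mono_left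
    (nhdsWithin_le_nhds (s := {t}ᶜ))) (ht.1.mono hR)

theorem brt_comp_add_left {a b : ℝ} (hab : a < b) (hcl : ∀ t ∈ Ioo a b, σ t ∈ closure Ω)
    (f : Euc n → ℝ) :
    brt f (b - a) (fun s => σ (a + s)) = ∫ t in Ioo a b, (closure Ω).indicator f (σ t) := by
  rw [brt, intervalIntegral.integral_comp_add_left (fun t => f (σ t)), add_zero, add_sub_cancel,
    intervalIntegral.integral_of_le hab.le, integral_Ioc_eq_integral_Ioo]
  exact setIntegral_congr_fun measurableSet_Ioo fun t ht => (indicator_of_mem (hcl t ht) f).symm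

theorem integrableOn_indicator_comp {f : Euc n → ℝ} (hσ : Continuous σ)
    (hf : Measurable ((closure Ω).indicator f)) (hbdd : ∃ M, ∀ x ∈ closure Ω, |f x| ≤ M)
    {s : Set ℝ} (hs : volume s ≠ ⊤) :
    IntegrableOn (fun t => (closure Ω).indicator f (σ t)) s := by
  obtain ⟨M, hM⟩ := hbdd
  refine Measure.integrableOn_of_bounded (M := |M|) hs
    (hf.comp hσ.measurable).aestronglyMeasurable (.of_forall fun t => ?_)
  by_cases ht : σ t ∈ closure Ω
  · exact (indicator_of_mem ht f).symm ▸ (hM _ ht).trans (le_abs_self M)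
  · simp only [indicator_of_notMem ht, norm_zero, abs_nonneg]

theorem IsReflectedPath.setIntegral_sub_eq_zero (h : IsReflectedPath Ω E σ B) (hΩ : IsOpen Ω)
    {a b : ℝ} (hint₁ : IntegrableOn (fun t => (closure Ω).indicator f₁ (σ t)) (Ioo a b))
    (hint₂ : IntegrableOn (fun t => (closure Ω).indicator f₂ (σ t)) (Ioo a b))
    (hsame : SameBrt Ω E f₁ f₂) (hab : a < b) (hsub : Ioo a b ⊆ excursionTimes Ω E σ)
    (ha : a ∉ excursionTimes Ω E σ) (hb : b ∉ excursionTimes Ω E σ) :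
    ∫ t in Ioo a b, Ω.indicator (f₁ - f₂) (σ t) = 0 := by
  have haE : σ a ∈ closure E := h.mem_closure_of_frequently hΩ ha <|
    (Eventually.frequently (mem_of_superset (Ioo_mem_nhdsGT hab) hsub)).filter_mono
      (nhdsGT_le_nhdsNE a)
  have hbE : σ b ∈ closure E := h.mem_closure_of_frequently hΩ hb <|
    (Eventually.frequently (mem_of_superset (Ioo_mem_nhdsLT hab) hsub)).filter_mono
      (nhdsLT_le_nhdsNE b)
  have hcl (t) (ht : t ∈ Ioo a b) : σ t ∈ closure Ω :=
    mem_closure_of_mem_excursionTimes h.continuous (hsub ht)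
  have hbrt := hsame _ _ (h.isBrokenRay hab (fun t ht => h.mem_or_mem_kinks hΩ (hsub ht)) haE hbE)
  rw [brt_comp_add_left hab hcl, brt_comp_add_left hab hcl, ← sub_eq_zero,
    ← integral_sub hint₁ hint₂] at hbrt
  rw [← hbrt]
  have hkinks : ∀ᵐ t : ℝ, t ∉ B := measure_eq_zero_iff_ae_notMem.1 (h.finite.measure_zero _)
  refine setIntegral_congr_ae measurableSet_Ioo ?_
  filter_upwards [hkinks] with t ht htab
  have hin : σ t ∈ Ω := (h.mem_or_mem_kinks hΩ (hsub htab)).resolve_right fun hB => ht hB.1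
  simp only [indicator_of_mem hin, indicator_of_mem (subset_closure hin), Pi.sub_apply]

theorem IsReflectedPath.integral_eq_zero (h : IsReflectedPath Ω E σ B) (hΩ : IsOpen Ω)
    (hf₁ : Measurable ((closure Ω).indicator f₁)) (hf₂ : Measurable ((closure Ω).indicator f₂))
    (hbdd₁ : ∃ M, ∀ x ∈ closure Ω, |f₁ x| ≤ M) (hbdd₂ : ∃ M, ∀ x ∈ closure Ω, |f₂ x| ≤ M)
    (hsame : SameBrt Ω E f₁ f₂) : ∫ t, Ω.indicator (f₁ - f₂) (σ t) = 0 := by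
  have hint₁ {s : Set ℝ} (hs : volume s ≠ ⊤) :=
    integrableOn_indicator_comp h.continuous hf₁ hbdd₁ hs
  have hint₂ {s : Set ℝ} (hs : volume s ≠ ⊤) :=
    integrableOn_indicator_comp h.continuous hf₂ hbdd₂ hs
  have hsupp (t : ℝ) (ht : t ∉ excursionTimes Ω E σ) : Ω.indicator (f₁ - f₂) (σ t) = 0 :=
    indicator_of_notMem (fun hin => ht (mem_excursionTimes_of_mem h.continuous hΩ hin)) _
  have hfinite : volume (excursionTimes Ω E σ) ≠ ⊤ := h.isBounded_excursionTimes.measure_lt_top.ne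
  rw [← setIntegral_eq_integral_of_forall_compl_eq_zero hsupp]
  refine setIntegral_eq_zero_of_forall_Ioo (isOpen_excursionTimes h.continuous hΩ)
    h.isBounded_excursionTimes ?_ fun a b hab hsub ha hb => h.setIntegral_sub_eq_zero hΩ
      (hint₁ measure_Ioo_lt_top.ne) (hint₂ measure_Ioo_lt_top.ne) hsame hab hsub ha hb
  refine (((hint₁ hfinite).sub (hint₂ hfinite)).indicator
    (h.continuous.measurable hΩ.measurableSet)).congr (.of_forall fun t => ?_)
  by_cases ht : σ t ∈ Ω
  · simp only [indicator_of_mem ht, indicator_of_mem (show t ∈ σ ⁻¹' Ω from ht),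
      indicator_of_mem (subset_closure ht), Pi.sub_apply]
  · simp only [indicator_of_notMem ht, indicator_of_notMem (show t ∉ σ ⁻¹' Ω from ht)]

end PathIntegrals

/-! ### Domains bounded locally by a hypersurface -/

section

variable {V : Type*} [NormedAddCommGroup V] [NormedSpace ℝ V] [CompleteSpace V] {ρ : V → ℝ}
  {ρ' : V →L[ℝ] ℝ} {q : V}

theorem exists_parametrization_with_coordinate (hρ : HasStrictFDerivAt ρ ρ' q) (hρ' : ρ' ≠ 0)
    (hq : ρ q = 0) {N : Set V} (hN : N ∈ 𝓝 q) :
    ∃ δ > 0, ∃ ψ : ℝ × ρ'.ker → V, ContinuousOn ψ (Ioo (-δ) δ ×ˢ Metric.ball 0 δ) ∧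
      ψ '' (Ioo (-δ) δ ×ˢ Metric.ball 0 δ) ∈ 𝓝 q ∧ ψ '' (Ioo (-δ) δ ×ˢ Metric.ball 0 δ) ⊆ N ∧
      ∀ z ∈ Ioo (-δ) δ ×ˢ Metric.ball 0 δ, ρ (ψ z) = z.1 := by
  have hrange : (ρ' : V →ₗ[ℝ] ℝ).range = ⊤ :=
    LinearMap.range_eq_top.2 <|
      LinearMap.surjective fun h => hρ' (ContinuousLinearMap.coe_injective h)
  let Φ := hρ.implicitToOpenPartialHomeomorph ρ ρ' hrange
  have hqΦ : q ∈ Φ.source := hρ.mem_implicitToOpenPartialHomeomorph_source hrange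
  have hΦq : Φ q = (0, 0) := hq ▸ hρ.implicitToOpenPartialHomeomorph_self hrange
  have hΦ0 : Φ.symm (0, 0) = q := hΦq ▸ Φ.left_inv hqΦ
  have h0 : ((0 : ℝ), (0 : ρ'.ker)) ∈ Φ.target := hΦq ▸ Φ.map_source hqΦ
  have hW : Φ.target ∩ Φ.symm ⁻¹' N ∈ 𝓝 ((0 : ℝ), (0 : ρ'.ker)) :=
    inter_mem (Φ.open_target.mem_nhds h0)
      ((Φ.continuousAt_symm h0).preimage_mem_nhds (hΦ0.symm ▸ hN))
  obtain ⟨δ, hδ, hbox⟩ := Metric.nhds_basis_ball.mem_iff.1 hW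
  rw [← ball_prod_same, Real.ball_eq_Ioo, zero_sub, zero_add] at hbox
  refine ⟨δ, hδ, Φ.symm, Φ.continuousOn_symm.mono fun z hz => (hbox hz).1, ?_,
    image_subset_iff.2 fun z hz => (hbox hz).2, fun z hz => ?_⟩
  · exact hΦ0 ▸ Φ.symm.image_mem_nhds h0
      (prod_mem_nhds (Ioo_mem_nhds (neg_lt_zero.2 hδ) hδ) (Metric.ball_mem_nhds _ hδ))
  · rw [← hρ.implicitToOpenPartialHomeomorph_fst hrange, Φ.right_inv (hbox hz).1]

theorem exists_nhds_isPreconnected_inter_pos (hρ : HasStrictFDerivAt ρ ρ' q) (hρ' : ρ' ≠ 0)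
    (hq : ρ q = 0) {N : Set V} (hN : N ∈ 𝓝 q) :
    ∃ U ∈ 𝓝 q, U ⊆ N ∧ IsPreconnected (U ∩ {y | 0 < ρ y}) ∧
      U ∩ {y | ρ y = 0} ⊆ closure (U ∩ {y | 0 < ρ y}) := by
  obtain ⟨δ, hδ, ψ, hψ, hnhds, hsub, hρψ⟩ := exists_parametrization_with_coordinate hρ hρ' hq hN
  have hupper : Ioo 0 δ ×ˢ Metric.ball (0 : ρ'.ker) δ ⊆ Ioo (-δ) δ ×ˢ Metric.ball 0 δ :=
    prod_mono (Ioo_subset_Ioo_left (by linarith)) Subset.rfl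
  have hpos : ψ '' (Ioo (-δ) δ ×ˢ Metric.ball 0 δ) ∩ {y | 0 < ρ y} =
      ψ '' (Ioo 0 δ ×ˢ Metric.ball 0 δ) := by
    refine Subset.antisymm ?_ ?_
    · rintro _ ⟨⟨z, hz, rfl⟩, hρz⟩
      exact ⟨z, ⟨⟨hρψ z hz ▸ hρz, hz.1.2⟩, hz.2⟩, rfl⟩
    · rintro _ ⟨z, hz, rfl⟩
      exact ⟨mem_image_of_mem _ (hupper hz), hz.1.1.trans_eq (hρψ z (hupper hz)).symm⟩
  refine ⟨_, hnhds, hsub, ?_, ?_⟩ <;> rw [hpos]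
  · exact ((convex_Ioo 0 δ).prod (convex_ball 0 δ)).isPreconnected.image _ (hψ.mono hupper)
  · rintro _ ⟨⟨z, hz, rfl⟩, hρz⟩
    refine ((hψ z hz).mono hupper).mem_closure_image ?_
    rw [closure_prod_eq, closure_Ioo hδ.ne]
    exact ⟨⟨((hρψ z hz).symm.trans hρz).ge, hz.1.2.le⟩, subset_closure hz.2⟩

end

/-- `ρ` is a `C¹` function, regular at `q` with unit normal `ν`, whose zero set near `q` contains
the boundary of `C` and does not meet `C`. So near `q` the set `C` is one side, or both sides, of
the hypersurface `ρ = 0`, or empty. -/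
structure IsDefiningFunction {V : Type*} [NormedAddCommGroup V] [InnerProductSpace ℝ V]
    [CompleteSpace V] (C : Set V) (q ν : V) (ρ : V → ℝ) : Prop where
  norm_eq_one : ‖ν‖ = 1
  contDiffAt : ContDiffAt ℝ 1 ρ q
  hasGradientAt : ∃ c : ℝ, c ≠ 0 ∧ HasGradientAt ρ (c • ν) q
  apply_eq_zero : ρ q = 0
  eventually_eq_zero : ∀ᶠ y in 𝓝 q, y ∈ frontier C → ρ y = 0
  eventually_notMem : ∀ᶠ y in 𝓝 q, ρ y = 0 → y ∉ C

namespace IsDefiningFunction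

section

variable {V : Type*} [NormedAddCommGroup V] [InnerProductSpace ℝ V] [CompleteSpace V] {C : Set V}
  {q ν : V} {ρ : V → ℝ}

theorem of_subset {D : Set V} (h : IsDefiningFunction D q ν ρ) (hCD : C ⊆ D)
    (hfr : ∀ᶠ y in 𝓝 q, y ∈ frontier C → y ∈ frontier D) : IsDefiningFunction C q ν ρ where
  norm_eq_one := h.norm_eq_one
  contDiffAt := h.contDiffAt
  hasGradientAt := h.hasGradientAt
  apply_eq_zero := h.apply_eq_zero
  eventually_eq_zero := by
    filter_upwards [h.eventually_eq_zero, hfr] with y hy hyCD hyC using hy (hyCD hyC)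
  eventually_notMem := h.eventually_notMem.mono fun y hy hρ hyC => hy hρ (hCD hyC)

theorem neg (h : IsDefiningFunction C q ν ρ) : IsDefiningFunction C q ν (-ρ) where
  norm_eq_one := h.norm_eq_one
  contDiffAt := h.contDiffAt.neg
  hasGradientAt := by
    obtain ⟨c, hc, hgrad⟩ := h.hasGradientAt
    refine ⟨-c, neg_ne_zero.2 hc, ?_⟩
    simpa only [hasGradientAt_iff_hasFDerivAt, neg_smul, map_neg] using hgrad.hasFDerivAt.neg
  apply_eq_zero := neg_eq_zero.2 h.apply_eq_zero
  eventually_eq_zero := h.eventually_eq_zero.mono fun y hy hyC => neg_eq_zero.2 (hy hyC)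
  eventually_notMem := h.eventually_notMem.mono fun y hy hρ => hy (neg_eq_zero.1 hρ)

theorem exists_nhds_inter_pos_subset (h : IsDefiningFunction C q ν ρ) (hC : IsOpen C)
    (hfreq : ∃ᶠ y in 𝓝 q, 0 < ρ y ∧ y ∈ C) :
    ∃ U ∈ 𝓝 q, U ∩ {y | 0 < ρ y} ⊆ C ∧ U ∩ {y | ρ y = 0} ⊆ closure (U ∩ {y | 0 < ρ y}) := by
  obtain ⟨c, hc, hgrad⟩ := h.hasGradientAt
  have hν : ν ≠ 0 := norm_ne_zero_iff.1 (h.norm_eq_one ▸ one_ne_zero)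
  obtain ⟨U, hU, hUfr, hconn, hcl⟩ := exists_nhds_isPreconnected_inter_pos
    (h.contDiffAt.hasStrictFDerivAt' hgrad.hasFDerivAt one_ne_zero)
    ((map_ne_zero_iff _ (LinearIsometryEquiv.injective _)).2 (smul_ne_zero hc hν))
    h.apply_eq_zero h.eventually_eq_zero
  obtain ⟨x, hx, hxU⟩ := (hfreq.and_eventually hU).exists
  refine ⟨U, hU, hconn.subset_of_closure_inter_subset hC ⟨x, ⟨hxU, hx.1⟩, hx.2⟩ ?_, hcl⟩
  rintro y ⟨hyC, hyU, hρy⟩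
  by_contra hy
  exact (hUfr hyU (hC.frontier_eq ▸ ⟨hyC, hy⟩)).not_gt hρy

theorem eventually_mem (h : IsDefiningFunction C q ν ρ) (hC : IsOpen C)
    (hfreq : ∃ᶠ y in 𝓝 q, 0 < ρ y ∧ y ∈ C) : ∀ᶠ y in 𝓝 q, 0 < ρ y → y ∈ C := by
  obtain ⟨U, hU, hUC, -⟩ := h.exists_nhds_inter_pos_subset hC hfreq
  exact mem_of_superset hU fun y hyU hρy => hUC ⟨hyU, hρy⟩

theorem eventually_mem_closure (h : IsDefiningFunction C q ν ρ) (hC : IsOpen C)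
    (hq : q ∈ closure C) : ∀ᶠ y in 𝓝 q, ρ y = 0 → y ∈ closure C := by
  have hcl {ρ : V → ℝ} (h : IsDefiningFunction C q ν ρ) (hfreq : ∃ᶠ y in 𝓝 q, 0 < ρ y ∧ y ∈ C) :
      ∀ᶠ y in 𝓝 q, ρ y = 0 → y ∈ closure C := by
    obtain ⟨U, hU, hUC, hUcl⟩ := h.exists_nhds_inter_pos_subset hC hfreq
    exact mem_of_superset hU fun y hyU hρy => closure_mono hUC (hUcl ⟨hyU, hρy⟩)
  have hsides : ∃ᶠ y in 𝓝 q, (0 < ρ y ∧ y ∈ C) ∨ (0 < (-ρ) y ∧ y ∈ C) := by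
    refine ((mem_closure_iff_frequently.1 hq).and_eventually h.eventually_notMem).mono ?_
    rintro y ⟨hyC, hy⟩
    rcases lt_trichotomy (ρ y) 0 with hneg | hzero | hpos
    exacts [.inr ⟨neg_pos.2 hneg, hyC⟩, (hy hzero hyC).elim, .inl ⟨hpos, hyC⟩]
  rcases frequently_or_distrib.1 hsides with hpos | hneg
  · exact hcl h hpos
  · exact (hcl h.neg hneg).mono fun y hy hρy => hy (neg_eq_zero.2 hρy)

end

theorem isUnitNormal {n : ℕ} {C : Set (Euc n)} {q ν : Euc n} {ρ : Euc n → ℝ}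
    (h : IsDefiningFunction C q ν ρ) (hC : IsOpen C) (hq : q ∈ frontier C) :
    IsUnitNormal (frontier C) q ν := by
  obtain ⟨c, hc, hgrad⟩ := h.hasGradientAt
  refine ⟨h.norm_eq_one, ρ, c, h.contDiffAt, hc, hgrad, h.apply_eq_zero, ?_⟩
  filter_upwards [h.eventually_eq_zero, h.eventually_notMem,
    h.eventually_mem_closure hC (frontier_subset_closure hq)] with y hfr hnot hcl
  exact ⟨hfr, fun hρ => hC.frontier_eq ▸ ⟨hcl hρ, hnot hρ⟩⟩

end IsDefiningFunction

/-! ### Lines folded into a sector -/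

theorem neg_one_zpow_eq_one_or (k : ℤ) : (-1 : ℝ) ^ k = 1 ∨ (-1 : ℝ) ^ k = -1 :=
  (Int.even_or_odd k).imp Even.neg_one_zpow Odd.neg_one_zpow

/-- The direction with polar angle `θ` in the plane with frame `(e, w)`. -/
noncomputable def planeDirection {V : Type*} [AddCommGroup V] [Module ℝ V] (e w : V) (θ : ℝ) : V :=
  Real.cos θ • e + Real.sin θ • w

section PlaneDirection

variable {V : Type*} [NormedAddCommGroup V] [InnerProductSpace ℝ V] {e w : V}

theorem continuous_planeDirection : Continuous (planeDirection e w) := by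
  unfold planeDirection
  fun_prop

theorem planeDirection_neg_one_zpow_mul (e w : V) (k : ℤ) (θ : ℝ) :
    planeDirection e w ((-1) ^ k * θ) = planeDirection e ((-1 : ℝ) ^ k • w) θ := by
  rcases neg_one_zpow_eq_one_or k with hk | hk <;> simp [planeDirection, hk]

theorem orthonormal_neg_one_zpow_smul (hew : Orthonormal ℝ ![e, w]) (k : ℤ) :
    Orthonormal ℝ ![e, (-1 : ℝ) ^ k • w] := by
  have hw : ‖w‖ = 1 := hew.1 1
  have hinner : ⟪e, w⟫_ℝ = 0 := hew.2 zero_ne_one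
  simp only [orthonormal_vecCons_iff, Fin.forall_fin_one, Matrix.cons_val_fin_one]
  refine ⟨hew.1 0, ?_, ?_, fun i => i.elim0, fun i => i.elim0, fun i => i.elim0⟩
  · rw [inner_smul_right, hinner, mul_zero]
  · rw [norm_smul, hw, norm_zpow, norm_neg, norm_one, one_zpow, one_mul]

theorem inner_planeDirection (hew : Orthonormal ℝ ![e, w]) (θ ψ : ℝ) :
    ⟪planeDirection e w θ, planeDirection e w ψ⟫_ℝ = Real.cos (θ - ψ) := by
  have he : ‖e‖ = 1 := hew.1 0
  have hw : ‖w‖ = 1 := hew.1 1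
  have hinner : ⟪e, w⟫_ℝ = 0 := hew.2 zero_ne_one
  simp only [planeDirection, inner_add_left, inner_add_right, inner_smul_left, inner_smul_right,
    real_inner_self_eq_norm_sq, he, hw, hinner, real_inner_comm e w, conj_trivial, Real.cos_sub]
  ring

theorem norm_planeDirection (hew : Orthonormal ℝ ![e, w]) (θ : ℝ) : ‖planeDirection e w θ‖ = 1 := by
  rw [← pow_eq_one_iff_of_nonneg (norm_nonneg _) two_ne_zero, ← real_inner_self_eq_norm_sq,
    inner_planeDirection hew, sub_self, Real.cos_zero]

theorem norm_smul_planeDirection (hew : Orthonormal ℝ ![e, w]) {r : ℝ} (hr : 0 ≤ r) (θ : ℝ) :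
    ‖r • planeDirection e w θ‖ = r := by
  rw [norm_smul, norm_planeDirection hew, mul_one, Real.norm_of_nonneg hr]

theorem inner_planeDirection_left (hew : Orthonormal ℝ ![e, w]) (θ : ℝ) :
    ⟪planeDirection e w θ, e⟫_ℝ = Real.cos θ := by
  simpa [planeDirection] using inner_planeDirection hew θ 0

theorem inner_planeDirection_right (hew : Orthonormal ℝ ![e, w]) (θ : ℝ) :
    ⟪planeDirection e w θ, w⟫_ℝ = Real.sin θ := by
  simpa [planeDirection, Real.cos_sub_pi_div_two] using inner_planeDirection hew θ (π / 2)

theorem abs_le_of_sqrt_smul_planeDirection_mem (hew : Orthonormal ℝ ![e, w]) {v : V} {p t θ R : ℝ}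
    (h : v + √(p ^ 2 + t ^ 2) • planeDirection e w θ ∈ Metric.closedBall v R) : |t| ≤ R := by
  rw [mem_closedBall_iff_norm, add_sub_cancel_left,
    norm_smul_planeDirection hew (Real.sqrt_nonneg _)] at h
  exact (Real.abs_le_sqrt (le_add_of_nonneg_left (sq_nonneg p))).trans h

theorem angle_planeDirection (hew : Orthonormal ℝ ![e, w]) {θ : ℝ} (hθ : |θ| ≤ π) :
    InnerProductGeometry.angle (planeDirection e w θ) e = |θ| := by
  have he : ‖e‖ = 1 := hew.1 0
  rw [InnerProductGeometry.angle, inner_planeDirection_left hew, norm_planeDirection hew, he,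
    mul_one, div_one, ← Real.cos_abs, Real.arccos_cos (abs_nonneg θ) hθ]

theorem planeDirection_reflect (e w : V) (θ ψ : ℝ) :
    planeDirection e w (2 * ψ - θ - π) =
      planeDirection e w θ - (2 * Real.cos (θ - ψ)) • planeDirection e w ψ := by
  have hψ : Real.cos ψ ^ 2 = 1 - Real.sin ψ ^ 2 := Real.cos_sq' ψ
  have hcos : Real.cos (2 * ψ - θ - π) =
      Real.cos θ - 2 * Real.cos (θ - ψ) * Real.cos ψ := by
    rw [Real.cos_sub_pi, Real.cos_sub, Real.cos_two_mul, Real.sin_two_mul, Real.cos_sub]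
    ring
  have hsin : Real.sin (2 * ψ - θ - π) =
      Real.sin θ - 2 * Real.cos (θ - ψ) * Real.sin ψ := by
    rw [Real.sin_sub_pi, Real.sin_sub, Real.cos_two_mul, Real.sin_two_mul, Real.cos_sub]
    linear_combination (2 * Real.sin θ) * hψ
  simp only [planeDirection, hcos, hsin]
  module

theorem sqrt_smul_planeDirection_add_arctan (e w : V) {p : ℝ} (hp : 0 < p) (t ψ : ℝ) :
    √(p ^ 2 + t ^ 2) • planeDirection e w (ψ + Real.arctan (t / p)) =
      p • planeDirection e w ψ + t • planeDirection e w (ψ + π / 2) := by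
  have hsqrt : √(p ^ 2 + t ^ 2) = p * √(1 + (t / p) ^ 2) := by
    have : p ^ 2 + t ^ 2 = p ^ 2 * (1 + (t / p) ^ 2) := by field_simp
    rw [this, Real.sqrt_mul (sq_nonneg p), Real.sqrt_sq hp.le]
  have : 0 < √(1 + (t / p) ^ 2) := Real.sqrt_pos.2 (by positivity)
  have hcos : √(p ^ 2 + t ^ 2) * Real.cos (ψ + Real.arctan (t / p)) =
      p * Real.cos ψ - t * Real.sin ψ := by
    rw [Real.cos_add, Real.cos_arctan, Real.sin_arctan, hsqrt]
    field_simp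
  have hsin : √(p ^ 2 + t ^ 2) * Real.sin (ψ + Real.arctan (t / p)) =
      p * Real.sin ψ + t * Real.cos ψ := by
    rw [Real.sin_add, Real.cos_arctan, Real.sin_arctan, hsqrt]
    field_simp
  simp only [planeDirection, smul_add, smul_smul, hcos, hsin, Real.cos_add_pi_div_two,
    Real.sin_add_pi_div_two]
  module

end PlaneDirection

/-- The triangle wave that folds the real line to the interval `[-α / 2, α / 2]`. -/
noncomputable def foldAngle (α θ : ℝ) : ℝ := α / π * Real.arcsin (Real.sin (π * θ / α))

theorem continuous_foldAngle (α : ℝ) : Continuous (foldAngle α) := by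
  have := Real.continuous_arcsin
  unfold foldAngle
  fun_prop

theorem periodic_foldAngle {α : ℝ} (hα : α ≠ 0) : Function.Periodic (foldAngle α) (2 * α) := by
  intro θ
  have : π * (θ + 2 * α) / α = π * θ / α + 2 * π := by field_simp
  simp only [foldAngle, this, Real.sin_add_two_pi]

section Fold

variable {α : ℝ}

theorem foldAngle_eq (hα : 0 < α) {θ : ℝ} {k : ℤ} (h : |θ - k * α| ≤ α / 2) :
    foldAngle α θ = (-1) ^ k * (θ - k * α) := by
  obtain ⟨hlow, hupp⟩ := abs_le.1 h
  have hshift : π * θ / α = π * (θ - k * α) / α + k * π := by field_simp; ring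
  have harcsin : Real.arcsin (Real.sin (π * (θ - k * α) / α)) = π * (θ - k * α) / α := by
    apply Real.arcsin_sin
    · rw [le_div_iff₀ hα]; nlinarith [Real.pi_pos]
    · rw [div_le_iff₀ hα]; nlinarith [Real.pi_pos]
  have hsign : Real.arcsin ((-1) ^ k * Real.sin (π * (θ - k * α) / α)) =
      (-1) ^ k * (π * (θ - k * α) / α) := by
    rcases neg_one_zpow_eq_one_or k with hk | hk <;>
      simp only [hk, one_mul, neg_one_mul, Real.arcsin_neg, harcsin]
  rw [foldAngle, hshift, Real.sin_add_int_mul_pi, hsign]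
  field_simp [Real.pi_ne_zero]

theorem exists_abs_sub_int_mul_le (hα : 0 < α) (θ : ℝ) :
    ∃ k : ℤ, |θ - k * α| ≤ α / 2 ∧ θ < k * α + α / 2 := by
  obtain ⟨k, ⟨hlow, hupp⟩, -⟩ := existsUnique_sub_zsmul_mem_Ico hα θ (-(α / 2))
  rw [zsmul_eq_mul] at hlow hupp
  exact ⟨k, abs_le.2 ⟨hlow, by linarith⟩, by linarith⟩

theorem abs_foldAngle_lt (hα : 0 < α) {θ : ℝ} (hθ : ∀ k : ℤ, θ ≠ k * α + α / 2) :
    |foldAngle α θ| < α / 2 := by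
  obtain ⟨k, hk, hlt⟩ := exists_abs_sub_int_mul_le hα θ
  rw [foldAngle_eq hα hk, abs_mul, abs_neg_one_zpow, one_mul, abs_lt]
  refine ⟨lt_of_le_of_ne (abs_le.1 hk).1 fun h => hθ (k - 1) ?_, by linarith⟩
  push_cast
  linarith

theorem exists_int_forall_abs_sub_le (hα : 0 < α) {θ : ℝ → ℝ} (hθ : Continuous θ)
    (hmono : Monotone θ) {x y : ℝ} (hno : ∀ t ∈ Ioo x y, ∀ k : ℤ, θ t ≠ k * α + α / 2) :
    ∃ k : ℤ, ∀ s ∈ Icc x y, |θ s - k * α| ≤ α / 2 := by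
  obtain ⟨k, hk, hlt⟩ := exists_abs_sub_int_mul_le hα (θ x)
  refine ⟨k, fun s hs => abs_le.2 ⟨?_, ?_⟩⟩
  · linarith [(abs_le.1 hk).1, hmono hs.1]
  · by_contra! hgt
    obtain ⟨t, ht, hθt⟩ := intermediate_value_Ioo hs.1 hθ.continuousOn
      (show k * α + α / 2 ∈ Ioo (θ x) (θ s) from ⟨hlt, by linarith⟩)
    exact hno t ⟨ht.1, ht.2.trans_le hs.2⟩ k hθt

end Fold

/-- The polar angle along a line at distance `p` from the origin, parametrized by arc length
starting from the point closest to the origin, which has polar angle `φ`. -/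
noncomputable def lineAngle (p φ t : ℝ) : ℝ := φ + Real.arctan (t / p)

theorem continuous_lineAngle (p φ : ℝ) : Continuous (lineAngle p φ) := by
  have := Real.continuous_arctan
  unfold lineAngle
  fun_prop

theorem strictMono_lineAngle {p : ℝ} (hp : 0 < p) (φ : ℝ) : StrictMono (lineAngle p φ) :=
  fun _ _ hst => add_lt_add_right (Real.arctan_strictMono (div_lt_div_of_pos_right hst hp)) φ

/-- The times at which a line meets one of the rays that are mapped to the boundary by the folding
of the plane to a sector of angle `α`. -/
def kinkTimes (α p φ : ℝ) : Set ℝ := {t | ∃ k : ℤ, lineAngle p φ t = k * α + α / 2}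

theorem finite_kinkTimes {α p : ℝ} (hα : 0 < α) (hp : 0 < p) (φ : ℝ) :
    (kinkTimes α p φ).Finite := by
  have hfin : ((fun k : ℤ => k * α + α / 2) ''
      Icc ⌈(φ - π / 2 - α / 2) / α⌉ ⌊(φ + π / 2 - α / 2) / α⌋).Finite := (finite_Icc _ _).image _
  refine (hfin.preimage (strictMono_lineAngle hp φ).injective.injOn).subset ?_
  rintro t ⟨k, hk⟩
  have hlow := Real.neg_pi_div_two_lt_arctan (t / p)
  have hupp := Real.arctan_lt_pi_div_two (t / p)
  have hk' : φ + Real.arctan (t / p) = k * α + α / 2 := hk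
  refine ⟨k, ⟨Int.ceil_le.2 ((div_le_iff₀ hα).2 ?_), Int.le_floor.2 ((le_div_iff₀ hα).2 ?_)⟩,
    hk.symm⟩ <;> linarith

/-- A line at distance `p` from the vertex of a plane with polar coordinates, folded into the sector
`|θ| ≤ α / 2` around the axis `e`. -/
noncomputable def foldedLine {V : Type*} [AddCommGroup V] [Module ℝ V] (v e w : V)
    (α p φ t : ℝ) : V :=
  v + √(p ^ 2 + t ^ 2) • planeDirection e w (foldAngle α (lineAngle p φ t))

section FoldedLine

variable {V : Type*} [NormedAddCommGroup V] [InnerProductSpace ℝ V] {v e w : V} {α p φ t : ℝ}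

theorem continuous_foldedLine : Continuous (foldedLine v e w α p φ) := by
  have hdir : Continuous fun t => planeDirection e w (foldAngle α (lineAngle p φ t)) :=
    continuous_planeDirection.comp ((continuous_foldAngle α).comp (continuous_lineAngle p φ))
  unfold foldedLine
  fun_prop

theorem foldedLine_eq (hα : 0 < α) (hp : 0 < p) {k : ℤ} (h : |lineAngle p φ t - k * α| ≤ α / 2) :
    foldedLine v e w α p φ t = v + p • planeDirection e ((-1 : ℝ) ^ k • w) (φ - k * α) +
      t • planeDirection e ((-1 : ℝ) ^ k • w) (φ - k * α + π / 2) := by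
  have hangle : lineAngle p φ t - k * α = φ - k * α + Real.arctan (t / p) := by
    unfold lineAngle
    ring
  rw [foldedLine, foldAngle_eq hα h, planeDirection_neg_one_zpow_mul, hangle,
    sqrt_smul_planeDirection_add_arctan _ _ hp, add_assoc]

theorem foldedLine_eq_add_smul (hα : 0 < α) (hp : 0 < p) {k : ℤ} {s : ℝ}
    (ht : |lineAngle p φ t - k * α| ≤ α / 2) (hs : |lineAngle p φ s - k * α| ≤ α / 2) :
    foldedLine v e w α p φ s = foldedLine v e w α p φ t +
      (s - t) • planeDirection e ((-1 : ℝ) ^ k • w) (φ - k * α + π / 2) := by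
  rw [foldedLine_eq hα hp ht, foldedLine_eq hα hp hs, sub_smul]
  abel

theorem foldedLine_of_lineAngle_eq (hα : 0 < α) {k : ℤ} (hk : lineAngle p φ t = k * α + α / 2) :
    foldedLine v e w α p φ t =
      v + √(p ^ 2 + t ^ 2) • planeDirection e ((-1 : ℝ) ^ k • w) (α / 2) := by
  have hdiff : lineAngle p φ t - k * α = α / 2 := by linarith
  rw [foldedLine, foldAngle_eq hα (k := k) (by rw [hdiff, abs_of_pos (half_pos hα)]), hdiff,
    planeDirection_neg_one_zpow_mul]

theorem eventually_foldedLine_before_kink (hα : 0 < α) (hp : 0 < p) {k : ℤ}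
    (hk : lineAngle p φ t = k * α + α / 2) :
    ∀ᶠ s in 𝓝[<] t, foldedLine v e w α p φ s = foldedLine v e w α p φ t +
      (s - t) • planeDirection e ((-1 : ℝ) ^ k • w) (φ - k * α + π / 2) := by
  have hnear : ∀ᶠ s in 𝓝 t, k * α - α / 2 < lineAngle p φ s :=
    (continuous_lineAngle p φ).continuousAt.eventually (lt_mem_nhds (by linarith))
  filter_upwards [nhdsWithin_le_nhds hnear, self_mem_nhdsWithin] with s hs hst
  have hlt := strictMono_lineAngle hp φ hst
  exact foldedLine_eq_add_smul hα hp (abs_le.2 ⟨by linarith, by linarith⟩)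
    (abs_le.2 ⟨by linarith, by linarith⟩)

theorem eventually_foldedLine_after_kink (hα : 0 < α) (hp : 0 < p) {k : ℤ}
    (hk : lineAngle p φ t = k * α + α / 2) :
    ∀ᶠ s in 𝓝[>] t, foldedLine v e w α p φ s = foldedLine v e w α p φ t +
      (s - t) • planeDirection e ((-1 : ℝ) ^ (k + 1) • w) (φ - (k + 1 : ℤ) * α + π / 2) := by
  have hnear : ∀ᶠ s in 𝓝 t, lineAngle p φ s < (k + 1) * α + α / 2 :=
    (continuous_lineAngle p φ).continuousAt.eventually (gt_mem_nhds (by linarith))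
  filter_upwards [nhdsWithin_le_nhds hnear, self_mem_nhdsWithin] with s hs hst
  have hlt := strictMono_lineAngle hp φ hst
  exact foldedLine_eq_add_smul hα hp
    (abs_le.2 ⟨by push_cast; linarith, by push_cast; linarith⟩)
    (abs_le.2 ⟨by push_cast; linarith, by push_cast; linarith⟩)

theorem planeDirection_succ_eq_reflect (hew : Orthonormal ℝ ![e, w]) (k : ℤ) :
    planeDirection e ((-1 : ℝ) ^ (k + 1) • w) (φ - (k + 1 : ℤ) * α + π / 2) =
      planeDirection e ((-1 : ℝ) ^ k • w) (φ - k * α + π / 2) -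
        (2 * ⟪planeDirection e ((-1 : ℝ) ^ k • w) (φ - k * α + π / 2),
          planeDirection e ((-1 : ℝ) ^ k • w) (α / 2 + π / 2)⟫_ℝ) •
            planeDirection e ((-1 : ℝ) ^ k • w) (α / 2 + π / 2) := by
  have hpow : ((-1 : ℝ) ^ (k + 1) • w) = (-1 : ℝ) ^ (1 : ℤ) • (-1 : ℝ) ^ k • w := by
    rw [smul_smul, add_comm, zpow_add₀ (neg_ne_zero.2 one_ne_zero)]
  rw [inner_planeDirection (orthonormal_neg_one_zpow_smul hew k), ← planeDirection_reflect, hpow,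
    ← planeDirection_neg_one_zpow_mul, zpow_one]
  congr 1
  push_cast
  ring

end FoldedLine

/-! ### Cones and their reflected paths -/

section OpenCone

variable {n : ℕ} {v e w u x : Euc n} {α : ℝ}

theorem add_smul_planeDirection_mem_openCone_iff (hew : Orthonormal ℝ ![e, w]) {r : ℝ} (hr : 0 < r)
    {θ : ℝ} (hθ : |θ| ≤ π) : v + r • planeDirection e w θ ∈ openCone v e α ↔ |θ| < α / 2 := by
  have hne : v + r • planeDirection e w θ ≠ v := by
    rw [Ne, add_eq_left, ← norm_eq_zero, norm_smul_planeDirection hew hr.le]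
    exact hr.ne'
  rw [openCone, mem_ofPred_eq, add_sub_cancel_left,
    InnerProductGeometry.angle_smul_left_of_pos _ _ hr, angle_planeDirection hew hθ,
    and_iff_right hne]

theorem foldedLine_mem_openCone_iff (hew : Orthonormal ℝ ![e, w]) (hα : 0 < α) (hα2 : α ≤ 2 * π)
    {p : ℝ} (hp : 0 < p) {φ t : ℝ} :
    foldedLine v e w α p φ t ∈ openCone v e α ↔ t ∉ kinkTimes α p φ := by
  have hsqrt : 0 < √(p ^ 2 + t ^ 2) := Real.sqrt_pos.2 (by positivity)
  refine ⟨?_, fun ht => ?_⟩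
  · rintro hcone ⟨k, hk⟩
    have hhalf : |α / 2| = α / 2 := abs_of_pos (half_pos hα)
    rw [foldedLine_of_lineAngle_eq hα hk, add_smul_planeDirection_mem_openCone_iff
      (orthonormal_neg_one_zpow_smul hew k) hsqrt (by linarith), hhalf] at hcone
    exact hcone.false
  · have hlt := abs_foldAngle_lt hα (θ := lineAngle p φ t) fun k hk => ht ⟨k, hk⟩
    exact (add_smul_planeDirection_mem_openCone_iff hew hsqrt (by linarith)).2 hlt

theorem continuousAt_angle_sub (hu : u ≠ 0) (hx : x ≠ v) :
    ContinuousAt (fun y => InnerProductGeometry.angle (y - v) u) x :=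
  ContinuousAt.comp (f := fun y => (y - v, u))
    (InnerProductGeometry.continuousAt_angle (sub_ne_zero.2 hx) hu) (by fun_prop)

theorem isOpen_openCone (hu : u ≠ 0) : IsOpen (openCone v u α) :=
  isOpen_iff_mem_nhds.2 fun _ hx => inter_mem (isOpen_ne.mem_nhds hx.1)
    ((continuousAt_angle_sub hu hx.1).eventually (gt_mem_nhds hx.2))

theorem eq_or_angle_eq_of_mem_frontier_openCone (hu : u ≠ 0) (hx : x ∈ frontier (openCone v u α)) :
    x = v ∨ InnerProductGeometry.angle (x - v) u = α / 2 := by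
  refine or_iff_not_imp_left.2 fun hxv => le_antisymm ?_ ?_
  · by_contra! hlt
    have hfreq := mem_closure_iff_frequently.1 (frontier_subset_closure hx)
    obtain ⟨y, hy, hy'⟩ := (hfreq.and_eventually
      ((continuousAt_angle_sub hu hxv).eventually (lt_mem_nhds hlt))).exists
    exact hy.2.not_gt hy'
  · by_contra! hlt
    exact ((isOpen_openCone hu).frontier_eq ▸ hx).2 ⟨hxv, hlt⟩

theorem openCone_smul {c : ℝ} (hc : 0 < c) : openCone v (c • u) α = openCone v u α := by
  simp only [openCone, InnerProductGeometry.angle_smul_right_of_pos _ _ hc]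

end OpenCone

section DefiningFunction

variable {V : Type*} [NormedAddCommGroup V] [InnerProductSpace ℝ V] {v q : V}

theorem hasGradientAt_inner_sub_mul_norm [CompleteSpace V] (hq : q ≠ v) (e : V) (κ : ℝ) :
    HasGradientAt (fun y => ⟪y - v, e⟫_ℝ - κ * ‖y - v‖) (e - (κ / ‖q - v‖) • (q - v)) q := by
  have hpos : 0 < ‖q - v‖ := norm_pos_iff.2 (sub_ne_zero.2 hq)
  have hsub : HasFDerivAt (fun y : V => y - v) (ContinuousLinearMap.id ℝ V) q :=
    (hasFDerivAt_id q).sub_const v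
  have hnorm := (hsub.norm_sq.sqrt (by positivity)).const_mul κ
  simp only [Real.sqrt_sq (norm_nonneg _)] at hnorm
  refine ((hsub.inner ℝ (hasFDerivAt_const e q)).sub hnorm).congr_fderiv ?_
  ext z
  simp [real_inner_comm]
  field_simp

theorem contDiffAt_inner_sub_mul_norm (hq : q ≠ v) (e : V) (κ : ℝ) :
    ContDiffAt ℝ 1 (fun y => ⟪y - v, e⟫_ℝ - κ * ‖y - v‖) q := by
  have hsub : ContDiffAt ℝ 1 (fun y : V => y - v) q := by fun_prop
  exact (hsub.inner ℝ contDiffAt_const).sub (contDiffAt_const.mul (hsub.norm ℝ (sub_ne_zero.2 hq)))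

theorem inner_eq_cos_mul_norm {e x : V} (he : ‖e‖ = 1) :
    ⟪x, e⟫_ℝ = Real.cos (InnerProductGeometry.angle x e) * ‖x‖ := by
  rw [← InnerProductGeometry.cos_angle_mul_norm_mul_norm, he, mul_one]

theorem isDefiningFunction_openCone {n : ℕ} {v e w : Euc n} (hew : Orthonormal ℝ ![e, w]) {α : ℝ}
    (hα : 0 < α) (hα2 : α < 2 * π) {r : ℝ} (hr : 0 < r) :
    IsDefiningFunction (openCone v e α) (v + r • planeDirection e w (α / 2))
      (planeDirection e w (α / 2 + π / 2))
      (fun y => ⟪y - v, e⟫_ℝ - Real.cos (α / 2) * ‖y - v‖) := by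
  have he : ‖e‖ = 1 := hew.1 0
  have hsin : 0 < Real.sin (α / 2) := Real.sin_pos_of_pos_of_lt_pi (half_pos hα) (by linarith)
  have hne : v + r • planeDirection e w (α / 2) ≠ v := by
    rw [Ne, add_eq_left, ← norm_eq_zero, norm_smul_planeDirection hew hr.le]
    exact hr.ne'
  refine ⟨norm_planeDirection hew _, contDiffAt_inner_sub_mul_norm hne e _,
    ⟨-Real.sin (α / 2), neg_ne_zero.2 hsin.ne', ?_⟩, ?_, .of_forall fun y hy => ?_,
    .of_forall fun y hy hyC => ?_⟩
  · convert hasGradientAt_inner_sub_mul_norm hne e (Real.cos (α / 2)) using 1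
    have hsq : e = (Real.sin (α / 2) ^ 2 + Real.cos (α / 2) ^ 2) • e := by
      rw [Real.sin_sq_add_cos_sq, one_smul]
    rw [add_sub_cancel_left, norm_smul_planeDirection hew hr.le, smul_smul,
      div_mul_cancel₀ _ hr.ne', planeDirection, planeDirection, Real.cos_add_pi_div_two,
      Real.sin_add_pi_div_two]
    nth_rewrite 2 [hsq]
    module
  · rw [add_sub_cancel_left, inner_smul_left, inner_planeDirection_left hew,
      norm_smul_planeDirection hew hr.le, conj_trivial, mul_comm, sub_self]
  · have he0 : e ≠ 0 := hew.ne_zero 0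
    rcases eq_or_angle_eq_of_mem_frontier_openCone he0 hy with rfl | hangle
    · simp
    · rw [inner_eq_cos_mul_norm he, hangle, sub_self]
  · have hcos : Real.cos (α / 2) < Real.cos (InnerProductGeometry.angle (y - v) e) :=
      Real.cos_lt_cos_of_nonneg_of_le_pi (InnerProductGeometry.angle_nonneg _ _) (by linarith) hyC.2
    rw [inner_eq_cos_mul_norm he, ← sub_mul, mul_eq_zero, norm_eq_zero, sub_eq_zero,
      sub_eq_zero] at hy
    exact hy.elim hcos.ne' hyC.1

theorem eq_inner_smul_add_inner_smul {e w : Euc 2} (hew : Orthonormal ℝ ![e, w]) (x : Euc 2) :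
    x = ⟪x, e⟫_ℝ • e + ⟪x, w⟫_ℝ • w := by
  let b := (basisOfOrthonormalOfCardEqFinrank hew (by simp)).toOrthonormalBasis (by simpa using hew)
  have hsum := b.sum_repr' x
  simp only [b, Fin.sum_univ_two, Module.Basis.coe_toOrthonormalBasis,
    coe_basisOfOrthonormalOfCardEqFinrank, Matrix.cons_val_zero, Matrix.cons_val_one,
    real_inner_comm x] at hsum
  exact hsum.symm

theorem isDefiningFunction_openCone_two_mul_pi {v e w : Euc 2} (hew : Orthonormal ℝ ![e, w]) {r : ℝ}
    (hr : 0 < r) :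
    IsDefiningFunction (openCone v e (2 * π)) (v + r • planeDirection e w π)
      (planeDirection e w (π + π / 2)) (fun y => ⟪y - v, w⟫_ℝ) := by
  have he : e ≠ 0 := hew.ne_zero 0
  have hinner : ⟪e, w⟫_ℝ = 0 := hew.2 zero_ne_one
  have hhalf : 2 * π / 2 = π := by ring
  have hbehind : ∀ᶠ y in 𝓝 (v + r • planeDirection e w π), ⟪y - v, e⟫_ℝ < 0 := by
    have hcont : Continuous fun y : Euc 2 => ⟪y - v, e⟫_ℝ := by fun_prop
    refine hcont.continuousAt.eventually (gt_mem_nhds ?_)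
    simpa only [add_sub_cancel_left, inner_smul_left, inner_planeDirection_left hew, Real.cos_pi,
      conj_trivial, mul_neg_one, neg_lt_zero] using hr
  have hsub : ContDiffAt ℝ 1 (fun y : Euc 2 => y - v) (v + r • planeDirection e w π) := by fun_prop
  refine ⟨norm_planeDirection hew _, hsub.inner ℝ contDiffAt_const, ⟨-1, by norm_num, ?_⟩, ?_,
    .of_forall fun y hy => ?_, hbehind.mono fun y hneg hy hyC => ?_⟩
  · have hnormal : (-1 : ℝ) • planeDirection e w (π + π / 2) = w := by
      simp [planeDirection, Real.cos_add_pi_div_two, Real.sin_add_pi_div_two]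
    rw [hnormal, hasGradientAt_iff_hasFDerivAt]
    refine (((hasFDerivAt_id _).sub_const v).inner ℝ (hasFDerivAt_const w _)).congr_fderiv ?_
    ext z
    simp [real_inner_comm]
  · rw [add_sub_cancel_left, inner_smul_left, inner_planeDirection_right hew, Real.sin_pi, mul_zero]
  · rcases eq_or_angle_eq_of_mem_frontier_openCone he hy with rfl | hangle
    · simp
    · rw [hhalf, InnerProductGeometry.angle_comm] at hangle
      obtain ⟨-, c, -, hc⟩ := InnerProductGeometry.angle_eq_pi_iff.1 hangle
      rw [hc, inner_smul_left, hinner, mul_zero]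
  · have hangle := hyC.2
    rw [eq_inner_smul_add_inner_smul hew (y - v), hy, zero_smul, add_zero,
      InnerProductGeometry.angle_smul_left_of_neg _ _ hneg,
      InnerProductGeometry.angle_neg_self_of_nonzero he, hhalf] at hangle
    exact hangle.false

theorem exists_isDefiningFunction_openCone {n : ℕ} {v e w : Euc n} (hew : Orthonormal ℝ ![e, w])
    {α : ℝ} (hα : 0 < α) (hα2 : α ≤ 2 * π) (hn : α < 2 * π ∨ n = 2) {r : ℝ} (hr : 0 < r) :
    ∃ ρ : Euc n → ℝ, IsDefiningFunction (openCone v e α) (v + r • planeDirection e w (α / 2))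
        (planeDirection e w (α / 2 + π / 2)) ρ ∧
      ∀ r' > (0 : ℝ), ∀ ψ ∈ Ioo 0 (α / 2), 0 < ρ (v + r' • planeDirection e w ψ) := by
  rcases hα2.lt_or_eq with hlt | rfl
  · refine ⟨_, isDefiningFunction_openCone hew hα hlt hr, fun r' hr' ψ hψ => ?_⟩
    have hcos : Real.cos (α / 2) < Real.cos ψ :=
      Real.cos_lt_cos_of_nonneg_of_le_pi hψ.1.le (by linarith) hψ.2
    rw [add_sub_cancel_left, inner_smul_left, inner_planeDirection_left hew,
      norm_smul_planeDirection hew hr'.le, conj_trivial, mul_comm, ← sub_mul]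
    exact mul_pos (sub_pos.2 hcos) hr'
  · obtain rfl : n = 2 := hn.resolve_left (lt_irrefl _)
    rw [mul_div_cancel_left₀ π two_ne_zero]
    refine ⟨_, isDefiningFunction_openCone_two_mul_pi hew hr, fun r' hr' ψ hψ => ?_⟩
    rw [add_sub_cancel_left, inner_smul_left, inner_planeDirection_right hew]
    exact mul_pos hr' (Real.sin_pos_of_pos_of_lt_pi hψ.1 hψ.2)

end DefiningFunction

/-- `Ω` is a bounded open set, not necessarily connected, in the cone with vertex `v`, axis
direction `u` and opening angle `α`, and the part of the boundary outside of `E` lies on the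
boundary of the cone. -/
structure IsConicalRegion {n : ℕ} (v u : Euc n) (α : ℝ) (Ω E : Set (Euc n)) : Prop where
  ne_zero : u ≠ 0
  pos : 0 < α
  le_two_mul_pi : α ≤ 2 * π
  isOpen : IsOpen Ω
  isBounded : Bornology.IsBounded Ω
  subset_cone : Ω ⊆ openCone v u α
  frontier_diff_subset : frontier Ω \ E ⊆ frontier (openCone v u α)

namespace IsConicalRegion

variable {n : ℕ} {v u e w : Euc n} {α : ℝ} {Ω E : Set (Euc n)}

theorem normalize (h : IsConicalRegion v u α Ω E) : IsConicalRegion v (‖u‖⁻¹ • u) α Ω E := by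
  have hpos : 0 < ‖u‖⁻¹ := inv_pos.2 (norm_pos_iff.2 h.ne_zero)
  exact { h with
    ne_zero := smul_ne_zero hpos.ne' h.ne_zero
    subset_cone := (openCone_smul hpos).symm ▸ h.subset_cone
    frontier_diff_subset := (openCone_smul hpos).symm ▸ h.frontier_diff_subset }

theorem subregion (h : IsConicalRegion v u α Ω E) {Ω' : Set (Euc n)} (hΩ' : IsOpen Ω')
    (hsub : Ω' ⊆ Ω) : IsConicalRegion v u α Ω' (frontier Ω' \ (frontier Ω \ E)) :=
  { h with
    isOpen := hΩ'
    isBounded := h.isBounded.subset hsub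
    subset_cone := hsub.trans h.subset_cone
    frontier_diff_subset := by
      rw [sdiff_sdiff_right_self]
      exact inter_subset_right.trans h.frontier_diff_subset }

theorem exists_isDefiningFunction_of_kink (h : IsConicalRegion v e α Ω E)
    (hew : Orthonormal ℝ ![e, w]) (hn : α < 2 * π ∨ n = 2) {p : ℝ} (hp : 0 < p) {φ t : ℝ} {k : ℤ}
    (hk : lineAngle p φ t = k * α + α / 2) (htE : foldedLine v e w α p φ t ∉ closure E) :
    ∃ ρ : Euc n → ℝ, IsDefiningFunction Ω (foldedLine v e w α p φ t)
        (planeDirection e ((-1 : ℝ) ^ k • w) (α / 2 + π / 2)) ρ ∧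
      ∀ᶠ s in 𝓝[≠] t, 0 < ρ (foldedLine v e w α p φ s) := by
  have hα := h.pos
  have hsqrt (s : ℝ) : 0 < √(p ^ 2 + s ^ 2) := Real.sqrt_pos.2 (by positivity)
  obtain ⟨ρ, hρ, hpos⟩ := exists_isDefiningFunction_openCone (v := v)
    (orthonormal_neg_one_zpow_smul hew k) hα h.le_two_mul_pi hn (hsqrt t)
  rw [← foldedLine_of_lineAngle_eq hα hk] at hρ
  refine ⟨ρ, hρ.of_subset h.subset_cone ?_, ?_⟩
  · filter_upwards [isClosed_closure.isOpen_compl.mem_nhds htE] with y hyE hy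
    exact h.frontier_diff_subset ⟨hy, fun hyE' => hyE (subset_closure hyE')⟩
  have hfold : foldAngle α (lineAngle p φ t) = (-1) ^ k * (α / 2) := by
    have hdiff : lineAngle p φ t - k * α = α / 2 := by linarith
    rw [foldAngle_eq hα (by rw [hdiff, abs_of_pos (half_pos hα)]), hdiff]
  have hside : ∀ᶠ s in 𝓝 t, 0 < (-1) ^ k * foldAngle α (lineAngle p φ s) := by
    have hcont := (continuous_foldAngle α).comp (continuous_lineAngle p φ)
    refine (hcont.const_mul _).continuousAt.eventually (lt_mem_nhds ?_)
    simp only [Function.comp_apply]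
    rw [hfold, ← mul_assoc, ← mul_zpow]
    simpa using hα
  have hno : ∀ᶠ s in 𝓝[≠] t, s ∉ kinkTimes α p φ :=
    nhdsNE_le_cofinite _ (finite_kinkTimes hα hp φ).eventually_cofinite_notMem
  filter_upwards [nhdsWithin_le_nhds hside, hno] with s hs hsno
  have hlt := abs_foldAngle_lt hα (θ := lineAngle p φ s) fun l hl => hsno ⟨l, hl⟩
  have hbound : (-1) ^ k * foldAngle α (lineAngle p φ s) < α / 2 :=
    (le_abs_self _).trans_lt (by rwa [abs_mul, abs_neg_one_zpow, one_mul])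
  convert hpos _ (hsqrt s) _ ⟨hs, hbound⟩ using 2
  rw [← planeDirection_neg_one_zpow_mul, ← mul_assoc, ← mul_zpow]
  simp [foldedLine]

theorem isReflectedPath_foldedLine (h : IsConicalRegion v e α Ω E) (hew : Orthonormal ℝ ![e, w])
    (hn : α < 2 * π ∨ n = 2) {p : ℝ} (hp : 0 < p) (φ : ℝ) :
    IsReflectedPath Ω E (foldedLine v e w α p φ) (kinkTimes α p φ) where
  continuous := continuous_foldedLine
  finite := finite_kinkTimes h.pos hp φ
  segment x y _ hno := by
    obtain ⟨k, hk⟩ := exists_int_forall_abs_sub_le h.pos (continuous_lineAngle p φ)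
      (strictMono_lineAngle hp φ).monotone fun t ht k hk => hno t ht ⟨k, hk⟩
    exact ⟨_, norm_planeDirection (orthonormal_neg_one_zpow_smul hew k) _, fun s hs =>
      foldedLine_eq_add_smul h.pos hp (hk x (left_mem_Icc.2 (hs.1.trans hs.2))) (hk s hs)⟩
  notMem t ht htΩ :=
    (foldedLine_mem_openCone_iff hew h.pos h.le_two_mul_pi hp).1 (h.subset_cone htΩ) ht
  tomography t ht hfr := by
    by_contra htE
    have hcone := h.frontier_diff_subset ⟨hfr, fun hE => htE (subset_closure hE)⟩
    rw [(isOpen_openCone h.ne_zero).frontier_eq] at hcone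
    exact hcone.2 ((foldedLine_mem_openCone_iff hew h.pos h.le_two_mul_pi hp).2 ht)
  inside := by
    rintro t ⟨k, hk⟩ ⟨-, htE⟩ hfreq
    obtain ⟨ρ, hρ, hpos⟩ := h.exists_isDefiningFunction_of_kink hew hn hp hk htE
    have htend : Tendsto (foldedLine v e w α p φ) (𝓝[≠] t) (𝓝 (foldedLine v e w α p φ t)) :=
      continuous_foldedLine.continuousAt.tendsto.mono_left nhdsWithin_le_nhds
    have hmem := hρ.eventually_mem h.isOpen <| htend.frequently <|
      (hfreq.and_eventually hpos).mono fun s hs => hs.symm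
    filter_upwards [htend.eventually hmem, hpos] with s hs hspos using hs hspos
  reflect := by
    rintro t ⟨k, hk⟩ ⟨hfr, htE⟩
    obtain ⟨ρ, hρ, -⟩ := h.exists_isDefiningFunction_of_kink hew hn hp hk htE
    exact ⟨_, _, _, hρ.isUnitNormal h.isOpen hfr, planeDirection_succ_eq_reflect hew k,
      eventually_foldedLine_before_kink h.pos hp hk, eventually_foldedLine_after_kink h.pos hp hk⟩
  bounded := by
    obtain ⟨R, hR⟩ := h.isBounded.subset_closedBall v
    exact ⟨R, fun t ht => abs_le_of_sqrt_smul_planeDirection_mem hew (hR ht)⟩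

end IsConicalRegion

theorem isReflectedPath_line {n : ℕ} {v e w : Euc n} {Ω E : Set (Euc n)}
    (hew : Orthonormal ℝ ![e, w]) (hΩ : Bornology.IsBounded Ω)
    (hE : ∀ r θ : ℝ, 0 < r → v + r • planeDirection e w θ ∉ frontier Ω \ E) {p : ℝ} (hp : 0 < p)
    (φ : ℝ) :
    IsReflectedPath Ω E
      (fun t => v + √(p ^ 2 + t ^ 2) • planeDirection e w (lineAngle p φ t)) ∅ where
  continuous := by
    have hdir := (continuous_planeDirection (e := e) (w := w)).comp (continuous_lineAngle p φ)
    simp only [Function.comp_def] at hdir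
    fun_prop
  finite := finite_empty
  segment x y _ _ := by
    refine ⟨_, norm_planeDirection hew (φ + π / 2), fun s _ => ?_⟩
    simp only [lineAngle, sqrt_smul_planeDirection_add_arctan _ _ hp, sub_smul]
    abel
  notMem := by simp
  tomography t _ hfr := by
    by_contra htE
    exact hE (√(p ^ 2 + t ^ 2)) (lineAngle p φ t) (Real.sqrt_pos.2 (by positivity))
      ⟨hfr, fun hmem => htE (subset_closure hmem)⟩
  inside := by simp
  reflect := by simp
  bounded := by
    obtain ⟨R, hR⟩ := hΩ.subset_closedBall v
    exact ⟨R, fun t ht => abs_le_of_sqrt_smul_planeDirection_mem hew (hR ht)⟩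

theorem ae_coe_of_ae_haarAddCircle {T : ℝ} [hT : Fact (0 < T)] {P : AddCircle T → Prop}
    (h : ∀ᵐ y ∂AddCircle.haarAddCircle, P y) : ∀ᵐ θ : ℝ, P (θ : AddCircle T) := by
  have hvol : ∀ᵐ y ∂(volume : Measure (AddCircle T)), P y := by
    rw [AddCircle.volume_eq_smul_haarAddCircle]
    exact Measure.ae_smul_measure h _
  have hperiod : ∀ k : ℤ,
      ∀ᵐ θ : ℝ ∂volume.restrict (Ioc (k • T) ((k + 1) • T)), P (θ : AddCircle T) := by
    intro k
    rw [add_smul, one_smul]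
    exact (AddCircle.measurePreserving_mk T (k • T)).quasiMeasurePreserving.ae hvol
  rw [← Measure.restrict_univ (μ := volume), ← iUnion_Ioc_zsmul hT.out]
  exact (ae_restrict_iUnion_iff _ _).2 hperiod

theorem ae_of_ae_polar {P : ℝ × ℝ → Prop} (hP : MeasurableSet {x | P x})
    (h : ∀ᵐ r : ℝ, 0 < r → ∀ᵐ θ : ℝ, θ ∈ Ioo (-π) π → P (r * Real.cos θ, r * Real.sin θ)) :
    ∀ᵐ x, P x := by
  have hmeas : MeasurableSet {x : ℝ × ℝ | P (x.1 * Real.cos x.2, x.1 * Real.sin x.2)} :=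
    (by fun_prop : Measurable fun x : ℝ × ℝ => (x.1 * Real.cos x.2, x.1 * Real.sin x.2)) hP
  have hpolar : ∀ᵐ x : ℝ × ℝ, x ∈ polarCoord.target → P (polarCoord.symm x) := by
    rw [Measure.volume_eq_prod, Measure.ae_prod_iff_ae_ae]
    · filter_upwards [h] with r hr
      by_cases h0 : 0 < r
      · filter_upwards [hr h0] with θ hθ hmem using hθ hmem.2
      · exact Eventually.of_forall fun θ hmem => absurd hmem.1 h0
    · exact (polarCoord.open_target.measurableSet.imp hmeas)
  have himage :
      volume (polarCoord.symm '' {x | ¬(x ∈ polarCoord.target → P (polarCoord.symm x))}) = 0 :=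
    addHaar_image_eq_zero_of_differentiableOn_of_addHaar_eq_zero volume
      (fun x _ => (hasFDerivAt_polarCoord_symm x).differentiableAt.differentiableWithinAt)
      hpolar
  filter_upwards [measure_eq_zero_iff_ae_notMem.1 himage,
    eventuallyEq_univ.1 polarCoord_source_ae_eq_univ] with x hx hsource
  by_contra hPx
  refine hx ⟨polarCoord x, ?_, polarCoord.left_inv hsource⟩
  simp only [mem_ofPred_eq, polarCoord.left_inv hsource]
  exact fun himp => hPx (himp (polarCoord.map_source hsource))

section Plane

variable {V : Type*} [NormedAddCommGroup V] [InnerProductSpace ℝ V] [MeasurableSpace V]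
  [BorelSpace V] [SecondCountableTopology V] {v e w : V} {g : V → ℝ} {M R : ℝ}

theorem ae_plane_eq_zero_of_line_integrals {T : ℝ} [Fact (0 < T)] {dir : AddCircle T → V}
    (hdir : Continuous dir) (hnorm : ∀ y, ‖dir y‖ = 1) (hg : Measurable g) (hM : ∀ x, |g x| ≤ M)
    (hR : ∀ x, R < ‖x - v‖ → g x = 0)
    (hid : ∀ r : ℝ, 0 < r → ∀ θ ∈ Ioo (-π) π, g (v + r • planeDirection e w θ) ≠ 0 →
      dir θ = planeDirection e w θ)
    (hline : ∀ p : ℝ, 0 < p → ∀ φ : ℝ,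
      ∫ t, g (v + √(p ^ 2 + t ^ 2) • dir (lineAngle p φ t : ℝ)) = 0) :
    ∀ᵐ x : ℝ × ℝ, g (v + x.1 • e + x.2 • w) = 0 := by
  let F : ℝ → AddCircle T → ℂ := fun r y => (g (v + r • dir y) : ℂ)
  have hcircles : ∀ᵐ r, 0 < r → F r =ᵐ[AddCircle.haarAddCircle] 0 := by
    refine ae_eq_zero_of_polar_line_integrals (M := M) (R := R) ?_ ?_ ?_ ?_
    · exact Complex.measurable_ofReal.comp (hg.comp (by fun_prop))
    · exact fun r y => by simpa only [F, Complex.norm_real, Real.norm_eq_abs] using hM _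
    · intro r y hr
      have hfar : R < ‖v + r • dir y - v‖ := by
        rw [add_sub_cancel_left, norm_smul, hnorm, mul_one]
        exact hr.trans_le (le_abs_self r)
      simp only [F, hR _ hfar, Complex.ofReal_zero]
    · intro p hp y
      obtain ⟨φ, rfl⟩ := QuotientAddGroup.mk_surjective y
      simp only [F]
      rw [integral_complex_ofReal, Complex.ofReal_eq_zero]
      simpa only [lineAngle, AddCircle.coe_add] using hline p hp φ
  refine ae_of_ae_polar (P := fun x => g (v + x.1 • e + x.2 • w) = 0)
    ((hg.comp (by fun_prop)) (measurableSet_singleton 0)) ?_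
  filter_upwards [hcircles] with r hr h0
  filter_upwards [ae_coe_of_ae_haarAddCircle (hr h0)] with θ hθ hmem
  have hpoint : v + (r * Real.cos θ) • e + (r * Real.sin θ) • w = v + r • planeDirection e w θ := by
    simp only [planeDirection]; module
  rw [hpoint]
  by_contra hne
  simp only [F, hid r h0 θ hmem hne, Pi.zero_apply, Complex.ofReal_eq_zero] at hθ
  exact hne hθ

end Plane

section Planes

variable {V : Type*} [NormedAddCommGroup V] [InnerProductSpace ℝ V]

theorem exists_orthonormal_decomposition {d : V} (hd : ‖d‖ = 1) {y : V}
    (hy : y ∉ Submodule.span ℝ {d}) :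
    ∃ (w : V) (a b : ℝ), Orthonormal ℝ ![d, w] ∧ b ≠ 0 ∧ y = a • d + b • w := by
  let z := y - ⟪d, y⟫_ℝ • d
  have hz : ‖z‖ ≠ 0 := norm_ne_zero_iff.2 fun h0 =>
    hy (Submodule.mem_span_singleton.2 ⟨⟪d, y⟫_ℝ, (sub_eq_zero.1 h0).symm⟩)
  refine ⟨‖z‖⁻¹ • z, ⟪d, y⟫_ℝ, ‖z‖, ?_, hz, ?_⟩
  · have hdz : ⟪d, z⟫_ℝ = 0 := by simp [z, inner_sub_right, inner_smul_right, hd]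
    have hnorm : ‖‖z‖⁻¹ • z‖ = 1 := by rw [norm_smul, norm_inv, norm_norm, inv_mul_cancel₀ hz]
    simp [orthonormal_vecCons_iff, hd, hnorm, inner_smul_right, hdz]
  · rw [smul_inv_smul₀ hz, add_sub_cancel]

theorem notMem_span_of_orthonormal {d e : V} (hed : Orthonormal ℝ ![e, d]) :
    e ∉ Submodule.span ℝ {d} := by
  intro hmem
  obtain ⟨c, hc⟩ := Submodule.mem_span_singleton.1 hmem
  have hd : ‖d‖ = 1 := hed.1 1
  have hinner : ⟪e, d⟫_ℝ = 0 := hed.2 zero_ne_one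
  have hc0 : c = 0 := by simpa [← hc, inner_smul_left, hd] using hinner
  exact hed.ne_zero 0 (by simp [← hc, hc0])

theorem ae_shear {P : ℝ × ℝ → Prop} (h : ∀ᵐ x, P x) (a : ℝ) {b : ℝ} (hb : b ≠ 0) :
    ∀ᵐ x : ℝ × ℝ, P (x.1 + x.2 * a, x.2 * b) := by
  let L : (ℝ × ℝ) ≃ₗ[ℝ] (ℝ × ℝ) :=
    { toFun := fun x => (x.1 + x.2 * a, x.2 * b)
      invFun := fun x => (x.1 - x.2 / b * a, x.2 / b)
      map_add' := fun x y => by ext <;> simp <;> ring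
      map_smul' := fun c x => by ext <;> simp <;> ring
      left_inv := fun x => by ext <;> simp [hb]
      right_inv := fun x => by ext <;> simp [hb] }
  exact (Measure.LinearMap.quasiMeasurePreserving volume (L : (ℝ × ℝ) →ₗ[ℝ] (ℝ × ℝ))
    L.isUnit_det'.ne_zero).ae h

variable [FiniteDimensional ℝ V] [MeasurableSpace V] [BorelSpace V] {v d : V} {g : V → ℝ}

theorem ae_notMem_span_of_card_lt {s : Finset V} (hs : s.card < Module.finrank ℝ V) :
    ∀ᵐ y : V, y ∉ Submodule.span ℝ (s : Set V) :=
  measure_eq_zero_iff_ae_notMem.1 <| Measure.addHaar_submodule volume _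
    (span_lt_top_of_card_lt_finrank (by simpa using hs)).ne

theorem ae_eq_zero_of_ae_planes (hg : Measurable g)
    (h : ∀ᵐ y : V, ∀ᵐ x : ℝ × ℝ, g (v + x.1 • d + x.2 • y) = 0) : ∀ᵐ x, g x = 0 := by
  have hmeas : Measurable fun z : V × (ℝ × ℝ) => g (v + z.2.1 • d + z.2.2 • z.1) :=
    hg.comp (by fun_prop)
  rw [Measure.ae_ae_comm (p := fun (y : V) (x : ℝ × ℝ) => g (v + x.1 • d + x.2 • y) = 0)
    (hmeas (measurableSet_singleton 0)), Measure.volume_eq_prod] at h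
  obtain ⟨t, ht⟩ := (Measure.ae_ae_of_ae_prod h).exists
  obtain ⟨s, hs, hs0⟩ := (ht.and (Measure.ae_ne volume 0)).exists
  have hscale : Measure.QuasiMeasurePreserving (fun x : V => s⁻¹ • (x - (v + t • d))) :=
    (Measure.quasiMeasurePreserving_smul volume (inv_ne_zero hs0)).comp
      (measurePreserving_sub_right volume (v + t • d)).quasiMeasurePreserving
  filter_upwards [hscale.ae hs] with x hx
  rwa [smul_inv_smul₀ hs0, add_sub_cancel] at hx

theorem ae_eq_zero_of_ae_orthonormal_planes (hV : 1 < Module.finrank ℝ V) (hg : Measurable g)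
    (hd : ‖d‖ = 1)
    (h : ∀ᵐ y : V, ∀ w, Orthonormal ℝ ![d, w] → y ∈ Submodule.span ℝ {w, d} →
      ∀ᵐ x : ℝ × ℝ, g (v + x.1 • d + x.2 • w) = 0) :
    ∀ᵐ x, g x = 0 := by
  refine ae_eq_zero_of_ae_planes (v := v) (d := d) hg ?_
  filter_upwards [h, ae_notMem_span_of_card_lt (s := {d}) (by simpa using hV)] with y hy hyd
  obtain ⟨w, a, b, hdw, hb, rfl⟩ := exists_orthonormal_decomposition hd (by simpa using hyd)
  have hplane := hy w hdw (Submodule.mem_span_pair.2 ⟨b, a, add_comm _ _⟩)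
  filter_upwards [ae_shear hplane a hb] with x hx
  rw [← hx]
  congr 1
  module

end Planes

namespace IsConicalRegion

variable {n : ℕ} {v e w d : Euc n} {α : ℝ} {Ω E : Set (Euc n)} {g : Euc n → ℝ}

theorem ae_plane_eq_zero_of_fold (h : IsConicalRegion v e α Ω E) (hew : Orthonormal ℝ ![e, w])
    (hn : α < 2 * π ∨ n = 2) (hg : Measurable g) (hM : ∃ M, ∀ x, |g x| ≤ M)
    (hg0 : ∀ x ∉ Ω, g x = 0)
    (hint : ∀ σ B, IsReflectedPath Ω E σ B → ∫ t, g (σ t) = 0) :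
    ∀ᵐ x : ℝ × ℝ, g (v + x.1 • e + x.2 • w) = 0 := by
  obtain ⟨M, hM⟩ := hM
  obtain ⟨R, hR⟩ := h.isBounded.subset_closedBall v
  have : Fact (0 < 2 * α) := ⟨mul_pos two_pos h.pos⟩
  have hper : Function.Periodic (fun θ => planeDirection e w (foldAngle α θ)) (2 * α) := fun θ => by
    simp only [periodic_foldAngle h.pos.ne' θ]
  refine ae_plane_eq_zero_of_line_integrals (dir := hper.lift) (R := R) ?_ ?_ hg hM ?_ ?_ ?_
  · exact continuous_quot_lift _ (continuous_planeDirection.comp (continuous_foldAngle α))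
  · exact QuotientAddGroup.mk_surjective.forall.2 fun θ => norm_planeDirection hew _
  · exact fun x hx => hg0 x fun hmem => hx.not_ge (mem_closedBall_iff_norm.1 (hR hmem))
  · intro r hr θ hθ hne
    have hcone : |θ| < α / 2 := (add_smul_planeDirection_mem_openCone_iff hew hr
      (abs_le.2 ⟨hθ.1.le, hθ.2.le⟩)).1 (h.subset_cone (not_imp_comm.1 (hg0 _) hne))
    have hfold := foldAngle_eq h.pos (θ := θ) (k := 0) (by simpa using hcone.le)
    simp only [Function.Periodic.lift_coe, hfold]
    simp
  · exact fun p hp φ => hint _ _ (h.isReflectedPath_foldedLine hew hn hp φ)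

theorem notMem_frontier_diff_of_notMem_span (h : IsConicalRegion v e (2 * π) Ω E)
    (hdw : Orthonormal ℝ ![d, w]) (he : e ∉ Submodule.span ℝ {w, d}) {r : ℝ} (hr : 0 < r) (θ : ℝ) :
    v + r • planeDirection d w θ ∉ frontier Ω \ E := by
  intro hmem
  rcases eq_or_angle_eq_of_mem_frontier_openCone h.ne_zero (h.frontier_diff_subset hmem) with
    hvertex | hangle
  · have hnorm := norm_smul_planeDirection hdw hr.le θ
    rw [add_eq_left.1 hvertex, norm_zero] at hnorm
    exact hr.ne hnorm
  · rw [add_sub_cancel_left, mul_div_cancel_left₀ _ two_ne_zero] at hangle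
    obtain ⟨-, c, -, he'⟩ := InnerProductGeometry.angle_eq_pi_iff.1 hangle
    refine he (Submodule.mem_span_pair.2 ⟨c * (r * Real.sin θ), c * (r * Real.cos θ), ?_⟩)
    rw [he', planeDirection]
    module

theorem ae_plane_eq_zero_of_line (h : IsConicalRegion v e (2 * π) Ω E)
    (hdw : Orthonormal ℝ ![d, w]) (he : e ∉ Submodule.span ℝ {w, d}) (hg : Measurable g)
    (hM : ∃ M, ∀ x, |g x| ≤ M) (hg0 : ∀ x ∉ Ω, g x = 0)
    (hint : ∀ σ B, IsReflectedPath Ω E σ B → ∫ t, g (σ t) = 0) :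
    ∀ᵐ x : ℝ × ℝ, g (v + x.1 • d + x.2 • w) = 0 := by
  obtain ⟨M, hM⟩ := hM
  obtain ⟨R, hR⟩ := h.isBounded.subset_closedBall v
  have : Fact (0 < 2 * π) := ⟨Real.two_pi_pos⟩
  have hper : Function.Periodic (planeDirection d w) (2 * π) := fun θ => by simp [planeDirection]
  refine ae_plane_eq_zero_of_line_integrals (dir := hper.lift) (R := R) ?_ ?_ hg hM ?_ ?_ ?_
  · exact continuous_quot_lift _ continuous_planeDirection
  · exact QuotientAddGroup.mk_surjective.forall.2 fun θ => norm_planeDirection hdw _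
  · exact fun x hx => hg0 x fun hmem => hx.not_ge (mem_closedBall_iff_norm.1 (hR hmem))
  · exact fun _ _ θ _ _ => hper.lift_coe θ
  · exact fun p hp φ => hint _ _ (isReflectedPath_line hdw h.isBounded
      (fun r θ hr => h.notMem_frontier_diff_of_notMem_span hdw he hr θ) hp φ)

theorem ae_eq_zero (h : IsConicalRegion v e α Ω E) (he : ‖e‖ = 1) (hn : 2 ≤ n)
    (hg : Measurable g) (hM : ∃ M, ∀ x, |g x| ≤ M) (hg0 : ∀ x ∉ Ω, g x = 0)
    (hint : ∀ σ B, IsReflectedPath Ω E σ B → ∫ t, g (σ t) = 0) : ∀ᵐ x, g x = 0 := by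
  have hrank : 1 < Module.finrank ℝ (Euc n) := by rw [finrank_euclideanSpace_fin]; exact hn
  by_cases hfold : α < 2 * π ∨ n = 2
  · exact ae_eq_zero_of_ae_orthonormal_planes hrank hg he <| .of_forall fun y w hew _ =>
      h.ae_plane_eq_zero_of_fold hew hfold hg hM hg0 hint
  obtain ⟨hα, hn_ne⟩ := not_or.1 hfold
  obtain rfl : α = 2 * π := le_antisymm h.le_two_mul_pi (not_lt.1 hα)
  obtain ⟨y₀, hy₀⟩ := (ae_notMem_span_of_card_lt (s := {e}) (by simpa using hrank)).exists
  obtain ⟨d, -, -, hed, -⟩ := exists_orthonormal_decomposition he (by simpa using hy₀)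
  classical
  have hgeneric := ae_notMem_span_of_card_lt (s := {e, d})
    (Finset.card_le_two.trans_lt (by rw [finrank_euclideanSpace_fin]; exact hn.lt_of_ne' hn_ne))
  refine ae_eq_zero_of_ae_orthonormal_planes (v := v) (d := d) hrank hg (hed.1 1) ?_
  filter_upwards [hgeneric] with y hy w hdw hyspan
  refine h.ae_plane_eq_zero_of_line hdw (fun hespan => hy ?_) hg hM hg0 hint
  have hw : w ∈ Submodule.span ℝ {e, d} :=
    mem_span_insert_exchange hespan (notMem_span_of_orthonormal hed)
  have hle : Submodule.span ℝ {w, d} ≤ Submodule.span ℝ {e, d} :=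
    Submodule.span_le.2 (insert_subset hw
      (singleton_subset_iff.2 (Submodule.subset_span (mem_insert_of_mem e rfl))))
  simpa only [Finset.coe_insert, Finset.coe_singleton] using hle hyspan

end IsConicalRegion

theorem eq_of_ae_eq_of_continuousWithinAt {X Y : Type*} [TopologicalSpace X] [MeasurableSpace X]
    [OpensMeasurableSpace X] {μ : Measure X} [μ.IsOpenPosMeasure] [TopologicalSpace Y] [T2Space Y]
    {f₁ f₂ : X → Y} {s : Set X} (hs : IsOpen s) (h : f₁ =ᵐ[μ.restrict s] f₂) {x : X}
    (hx : x ∈ closure s) (hf₁ : ContinuousWithinAt f₁ s x) (hf₂ : ContinuousWithinAt f₂ s x) :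
    f₁ x = f₂ x := by
  set S := s ∩ {y | y ∈ s → f₁ y = f₂ y}
  have hS : S ⊆ s := inter_subset_left
  have hdense : Dense {y | y ∈ s → f₁ y = f₂ y} :=
    Measure.dense_of_ae ((ae_restrict_iff' hs.measurableSet).1 h)
  have hne : (𝓝[S] x).NeBot := mem_closure_iff_nhdsWithin_neBot.1
    (closure_minimal (hdense.open_subset_closure_inter hs) isClosed_closure hx)
  refine tendsto_nhds_unique_of_eventuallyEq (hf₁.mono hS) (hf₂.mono hS) ?_
  filter_upwards [self_mem_nhdsWithin] with y hy using hy.2 hy.1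

theorem measurable_indicator_of_domRestrict {X Y : Type*} [MeasurableSpace X] [MeasurableSpace Y]
    [Zero Y] {s : Set X} (hs : MeasurableSet s) {f : X → Y} (hf : Measurable (s.domRestrict f)) :
    Measurable (s.indicator f) := by
  refine measurable_of_restrict_of_restrict_compl hs ?_ ?_
  · rwa [show s.domRestrict (s.indicator f) = s.domRestrict f from
      funext fun x => indicator_of_mem x.2 f]
  · rw [show sᶜ.domRestrict (s.indicator f) = fun _ => 0 from
      funext fun x => indicator_of_notMem x.2 f]
    exact measurable_const

namespace IsConicalRegion

variable {n : ℕ} {v u : Euc n} {α : ℝ} {Ω E : Set (Euc n)} {f₁ f₂ : Euc n → ℝ}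

theorem ae_eq_of_sameBrt (h : IsConicalRegion v u α Ω E) (hn : 2 ≤ n)
    (hf₁ : Measurable ((closure Ω).domRestrict f₁)) (hf₂ : Measurable ((closure Ω).domRestrict f₂))
    (hbdd₁ : ∃ M, ∀ x ∈ closure Ω, |f₁ x| ≤ M) (hbdd₂ : ∃ M, ∀ x ∈ closure Ω, |f₂ x| ≤ M)
    (hsame : SameBrt Ω E f₁ f₂) : f₁ =ᵐ[volume.restrict Ω] f₂ := by
  have hind₁ := measurable_indicator_of_domRestrict isClosed_closure.measurableSet hf₁
  have hind₂ := measurable_indicator_of_domRestrict isClosed_closure.measurableSet hf₂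
  have hdiff : Ω.indicator (f₁ - f₂) =
      Ω.indicator ((closure Ω).indicator f₁ - (closure Ω).indicator f₂) :=
    indicator_congr fun x hx => by simp [subset_closure hx]
  have hmeas : Measurable (Ω.indicator (f₁ - f₂)) :=
    hdiff ▸ (hind₁.sub hind₂).indicator h.isOpen.measurableSet
  have hbdd : ∃ M, ∀ x, |Ω.indicator (f₁ - f₂) x| ≤ M := by
    obtain ⟨M₁, hM₁⟩ := hbdd₁
    obtain ⟨M₂, hM₂⟩ := hbdd₂
    refine ⟨max 0 (M₁ + M₂), fun x => ?_⟩
    by_cases hx : x ∈ Ω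
    · rw [indicator_of_mem hx]
      exact (abs_sub _ _).trans ((add_le_add (hM₁ x (subset_closure hx))
        (hM₂ x (subset_closure hx))).trans (le_max_right _ _))
    · simp [indicator_of_notMem hx]
  have hunit : ‖‖u‖⁻¹ • u‖ = 1 := norm_smul_inv_norm h.ne_zero
  have hae := h.normalize.ae_eq_zero hunit hn hmeas hbdd (fun x hx => indicator_of_notMem hx _)
    fun σ B hσ => hσ.integral_eq_zero h.isOpen hind₁ hind₂ hbdd₁ hbdd₂ hsame
  refine (ae_restrict_iff' h.isOpen.measurableSet).2 (hae.mono fun x hx hxΩ => ?_)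
  rw [indicator_of_mem hxΩ] at hx
  exact sub_eq_zero.1 hx

theorem brtInjective (h : IsConicalRegion v u α Ω E) (hn : 2 ≤ n) : BrtInjective Ω E := by
  constructor
  · rintro f₁ f₂ ⟨-, hm₁, hb₁⟩ ⟨-, hm₂, hb₂⟩ hsame
    have hae := h.ae_eq_of_sameBrt hn hm₁ hm₂ hb₁ hb₂ hsame
    exact ⟨hae, fun x hx hf₁ hf₂ => eq_of_ae_eq_of_continuousWithinAt h.isOpen hae hx
      (hf₁.mono subset_closure) (hf₂.mono subset_closure)⟩
  · intro f₁ f₂ hf₁ hf₂ hsame x hx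
    have hae := h.ae_eq_of_sameBrt hn (continuousOn_iff_continuous_domRestrict.1 hf₁).measurable
      (continuousOn_iff_continuous_domRestrict.1 hf₂).measurable
      (h.isBounded.isCompact_closure.exists_bound_of_continuousOn hf₁)
      (h.isBounded.isCompact_closure.exists_bound_of_continuousOn hf₂) hsame
    exact eq_of_ae_eq_of_continuousWithinAt h.isOpen hae hx
      ((hf₁ x hx).mono subset_closure) ((hf₂ x hx).mono subset_closure)

end IsConicalRegion

section SublevelSets

variable {X Y : Type*} [TopologicalSpace X] [LinearOrder Y] [TopologicalSpace Y]
  [OrderClosedTopology Y] {C : Set X} {f g : X → Y}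

theorem isOpen_sep_lt (hC : IsOpen C) (hf : ContinuousOn f C) (hg : ContinuousOn g C) :
    IsOpen {x ∈ C | f x < g x} :=
  isOpen_iff_mem_nhds.2 fun _ hx => (hC.eventually_mem hx.1).and <|
    (hf.continuousAt (hC.mem_nhds hx.1)).eventually_lt (hg.continuousAt (hC.mem_nhds hx.1)) hx.2

theorem frontier_sep_lt_diff_subset (hC : IsOpen C) (hf : ContinuousOn f C)
    (hg : ContinuousOn g C) : frontier {x ∈ C | f x < g x} \ {x ∈ C | f x = g x} ⊆ frontier C := by
  rintro x ⟨hx, hne⟩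
  rw [(isOpen_sep_lt hC hf hg).frontier_eq] at hx
  rw [hC.frontier_eq]
  refine ⟨closure_mono (sep_subset _ _) hx.1, fun hxC => ?_⟩
  have hlt : g x < f x :=
    lt_of_le_of_ne (not_lt.1 fun hlt => hx.2 ⟨hxC, hlt⟩) fun heq => hne ⟨hxC, heq.symm⟩
  have hnear := (hg.continuousAt (hC.mem_nhds hxC)).eventually_lt
    (hf.continuousAt (hC.mem_nhds hxC)) hlt
  obtain ⟨y, hy, hy'⟩ := ((mem_closure_iff_frequently.1 hx.1).and_eventually hnear).exists
  exact hy.2.not_gt hy'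

end SublevelSets

section Cones

variable {n : ℕ} {u : Euc n} {α : ℝ}

theorem isConicalRegion_sep_norm_lt (hu : u ≠ 0) (hα : α ∈ Ioc 0 (2 * π)) {G : Euc n → ℝ}
    (hG : ContinuousOn G (openCone 0 u α)) (hbdd : BddAbove (G '' openCone 0 u α))
    {E : Set (Euc n)} (hE : {x ∈ openCone 0 u α | ‖x‖ = G x} ⊆ E) :
    IsConicalRegion 0 u α {x ∈ openCone 0 u α | ‖x‖ < G x} E where
  ne_zero := hu
  pos := hα.1
  le_two_mul_pi := hα.2
  isOpen := isOpen_sep_lt (isOpen_openCone hu) continuous_norm.continuousOn hG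
  isBounded := by
    obtain ⟨M, hM⟩ := hbdd
    exact (Metric.isBounded_closedBall (x := 0) (r := M)).subset fun x hx =>
      mem_closedBall_zero_iff.2 (hx.2.le.trans (hM (mem_image_of_mem G hx.1)))
  subset_cone := sep_subset _ _
  frontier_diff_subset := (sdiff_subset_sdiff_right hE).trans
    (frontier_sep_lt_diff_subset (isOpen_openCone hu) continuous_norm.continuousOn hG)

theorem isConicalRegion_radialDomain (hu : u ≠ 0) (hα : α ∈ Ioc 0 (2 * π)) {h : Euc n → ℝ}
    (hh : ContinuousOn h (Metric.sphere 0 1)) :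
    IsConicalRegion 0 u α (radialDomain (openCone 0 u α) h) (radialGraph (openCone 0 u α) h) := by
  have hdom : radialDomain (openCone 0 u α) h =
      {x ∈ openCone 0 u α | ‖x‖ < h (‖x‖⁻¹ • x)} := by
    ext x
    exact and_congr_right fun hx => and_iff_right (norm_pos_iff.2 hx.1)
  have hsphere : MapsTo (fun x : Euc n => ‖x‖⁻¹ • x) (openCone 0 u α) (Metric.sphere 0 1) :=
    fun x hx => mem_sphere_zero_iff_norm.2 (norm_smul_inv_norm hx.1)
  have hnormalize : ContinuousOn (fun x : Euc n => ‖x‖⁻¹ • x) (openCone 0 u α) :=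
    (continuous_norm.continuousOn.inv₀ fun x hx => norm_ne_zero_iff.2 hx.1).smul continuousOn_id
  rw [hdom]
  refine isConicalRegion_sep_norm_lt hu hα (hh.comp hnormalize hsphere) ?_
    fun x hx => ⟨hx.1, norm_pos_iff.2 hx.1.1, hx.2⟩
  refine ((isCompact_sphere 0 1).bddAbove_image hh).mono ?_
  rw [image_comp]
  exact image_mono hsphere.image_subset

theorem mem_openCone_two_mul_arctan_iff {e : Euc n} (he : ‖e‖ = 1) {k : ℝ} (hk : 0 < k)
    (x : Euc n) : x ∈ openCone 0 e (2 * Real.arctan k) ↔ ‖x - ⟪x, e⟫_ℝ • e‖ < k * ⟪x, e⟫_ℝ := by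
  have hpythagoras : ‖x - ⟪x, e⟫_ℝ • e‖ ^ 2 = ‖x‖ ^ 2 - ⟪x, e⟫_ℝ ^ 2 := by
    rw [norm_sub_sq_real, inner_smul_right, norm_smul, he, Real.norm_eq_abs, mul_one, sq_abs]
    ring
  have hsqrt : √(1 + k ^ 2) ^ 2 = 1 + k ^ 2 := Real.sq_sqrt (by positivity)
  have hcos : x ≠ 0 → (InnerProductGeometry.angle x e < Real.arctan k ↔
      ‖x‖ < ⟪x, e⟫_ℝ * √(1 + k ^ 2)) := fun hx => by
    rw [← Real.strictAntiOn_cos.lt_iff_gt ⟨(Real.arctan_pos.2 hk).le,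
      (Real.arctan_lt_pi_div_two k).le.trans (half_le_self Real.pi_pos.le)⟩
      ⟨InnerProductGeometry.angle_nonneg _ _, InnerProductGeometry.angle_le_pi _ _⟩,
      InnerProductGeometry.cos_angle, he, Real.cos_arctan, mul_one,
      div_lt_div_iff₀ (by positivity) (norm_pos_iff.2 hx), one_mul]
  change x ≠ 0 ∧ InnerProductGeometry.angle (x - 0) e < 2 * Real.arctan k / 2 ↔ _
  rw [sub_zero, mul_div_cancel_left₀ _ two_ne_zero]
  rcases le_or_gt ⟪x, e⟫_ℝ 0 with hneg | hpos
  · refine iff_of_false (fun ⟨hx, hlt⟩ => ?_) ?_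
    · exact ((norm_nonneg x).trans_lt ((hcos hx).1 hlt)).not_ge
        (mul_nonpos_of_nonpos_of_nonneg hneg (Real.sqrt_nonneg _))
    · exact not_lt.2 ((mul_nonpos_of_nonneg_of_nonpos hk.le hneg).trans (norm_nonneg _))
  · have hx : x ≠ 0 := by rintro rfl; simp at hpos
    rw [and_iff_right hx, hcos hx, ← sq_lt_sq₀ (norm_nonneg _) (by positivity),
      ← sq_lt_sq₀ (norm_nonneg (_ - _)) (by positivity), mul_pow, hsqrt, hpythagoras]
    constructor <;> intro hlt <;> linarith

theorem norm_castSucc_eq {d : ℕ} (x : Euc (d + 1)) :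
    ‖(WithLp.toLp 2 (fun i : Fin d => x i.castSucc) : Euc d)‖ =
      ‖x - x (Fin.last d) • EuclideanSpace.single (Fin.last d) (1 : ℝ)‖ := by
  rw [← sq_eq_sq₀ (norm_nonneg _) (norm_nonneg _), EuclideanSpace.norm_sq_eq,
    EuclideanSpace.norm_sq_eq, Fin.sum_univ_castSucc]
  simp

theorem slopeCone_of_pos (d : ℕ) {k : ℝ} (hk : 0 < k) :
    slopeCone d k = openCone 0 (EuclideanSpace.single (Fin.last d) 1) (2 * Real.arctan k) := by
  ext x
  rw [mem_openCone_two_mul_arctan_iff (by simp) hk]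
  simp [slopeCone, norm_castSucc_eq, EuclideanSpace.inner_single_right]

theorem slopeCone_of_neg (d : ℕ) {k : ℝ} (hk : k < 0) :
    slopeCone d k = openCone 0 (-EuclideanSpace.single (Fin.last d) 1) (2 * Real.arctan (-k)) := by
  ext x
  rw [mem_openCone_two_mul_arctan_iff (by simp) (neg_pos.2 hk)]
  simp [slopeCone, norm_castSucc_eq, EuclideanSpace.inner_single_right]

theorem two_mul_arctan_mem_Ioc {k : ℝ} (hk : 0 < k) : 2 * Real.arctan k ∈ Ioc 0 (2 * π) :=
  ⟨mul_pos two_pos (Real.arctan_pos.2 hk), by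
    linarith [Real.arctan_lt_pi_div_two k, Real.pi_pos]⟩

theorem exists_isConicalRegion_slopeCone (d : ℕ) (k : ℝ) {h : Euc (d + 1) → ℝ}
    (hh : ContinuousOn h (Metric.sphere 0 1)) :
    ∃ u α, IsConicalRegion 0 u α (radialDomain (slopeCone d k) h)
      (radialGraph (slopeCone d k) h) := by
  have haxis : EuclideanSpace.single (Fin.last d) (1 : ℝ) ≠ 0 := by
    rw [← norm_ne_zero_iff]; simp
  rcases lt_trichotomy k 0 with hk | rfl | hk
  · rw [slopeCone_of_neg d hk]
    exact ⟨_, _, isConicalRegion_radialDomain (neg_ne_zero.2 haxis)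
      (two_mul_arctan_mem_Ioc (neg_pos.2 hk)) hh⟩
  · have hempty : radialDomain (slopeCone d 0) h = ∅ :=
      eq_empty_of_forall_notMem fun x hx => (norm_nonneg _).not_gt (by simpa [slopeCone] using hx.1)
    rw [hempty]
    exact ⟨_, 2 * π, haxis, Real.two_pi_pos, le_rfl, isOpen_empty, Bornology.isBounded_empty,
      empty_subset _, by simp⟩
  · rw [slopeCone_of_pos d hk]
    exact ⟨_, _, isConicalRegion_radialDomain haxis (two_mul_arctan_mem_Ioc hk) hh⟩

end Cones

/-- The polar angle, with values in `(-π, π]`, of a point of the plane with respect to the frame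
`(e, w)`. Reading off coordinates in `ℂ` makes `Complex.arg` available; the value at `0` is `0`. -/
noncomputable def planeAngle (e w x : Euc 2) : ℝ :=
  Complex.arg ⟨⟪x, e⟫_ℝ, ⟪x, w⟫_ℝ⟩

section PlaneAngle

variable {e w : Euc 2} {α : ℝ}

theorem norm_inner_mk_inner (hew : Orthonormal ℝ ![e, w]) (x : Euc 2) :
    ‖(⟨⟪x, e⟫_ℝ, ⟪x, w⟫_ℝ⟩ : ℂ)‖ = ‖x‖ := by
  have hnorm := congrArg (⟪x, ·⟫_ℝ) (eq_inner_smul_add_inner_smul hew x)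
  rw [← sq_eq_sq₀ (norm_nonneg _) (norm_nonneg _), Complex.sq_norm, Complex.normSq_mk,
    ← real_inner_self_eq_norm_sq, hnorm, inner_add_right, inner_smul_right, inner_smul_right]

theorem planeAngle_smul_planeDirection (hew : Orthonormal ℝ ![e, w]) {r : ℝ} (hr : 0 < r) {ψ : ℝ}
    (hψ : ψ ∈ Ioc (-π) π) : planeAngle e w (r • planeDirection e w ψ) = ψ := by
  have hpolar : (⟨⟪r • planeDirection e w ψ, e⟫_ℝ, ⟪r • planeDirection e w ψ, w⟫_ℝ⟩ : ℂ) =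
      r * (Complex.cos ψ + Complex.sin ψ * Complex.I) := by
    rw [← Complex.ofReal_cos, ← Complex.ofReal_sin]
    simp only [inner_smul_left, inner_planeDirection_left hew, inner_planeDirection_right hew]
    apply Complex.ext <;> simp [-Complex.ofReal_cos, -Complex.ofReal_sin]
  rw [planeAngle, hpolar, Complex.arg_mul_cos_add_sin_mul_I hr hψ]

theorem norm_smul_planeDirection_planeAngle (hew : Orthonormal ℝ ![e, w]) (x : Euc 2) :
    ‖x‖ • planeDirection e w (planeAngle e w x) = x := by
  rw [← norm_inner_mk_inner hew x, planeDirection, smul_add, smul_smul, smul_smul, planeAngle,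
    Complex.norm_mul_cos_arg, Complex.norm_mul_sin_arg]
  exact (eq_inner_smul_add_inner_smul hew x).symm

theorem abs_planeAngle_lt (hew : Orthonormal ℝ ![e, w]) {x : Euc 2} (hx : x ∈ openCone 0 e α) :
    |planeAngle e w x| < α / 2 := by
  refine (add_smul_planeDirection_mem_openCone_iff (v := 0) hew (norm_pos_iff.2 hx.1)
    (Complex.abs_arg_le_pi _)).1 ?_
  change 0 + ‖x‖ • planeDirection e w (planeAngle e w x) ∈ _
  rwa [norm_smul_planeDirection_planeAngle hew, zero_add]

theorem continuousOn_planeAngle (hew : Orthonormal ℝ ![e, w]) (hα : α ≤ 2 * π) :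
    ContinuousOn (planeAngle e w) (openCone 0 e α) := fun x hx => by
  have hslit : (⟨⟪x, e⟫_ℝ, ⟪x, w⟫_ℝ⟩ : ℂ) ∈ Complex.slitPlane := by
    refine Complex.mem_slitPlane_iff_arg.2 ⟨fun harg => ?_, ?_⟩
    · linarith [le_abs_self (planeAngle e w x), abs_planeAngle_lt hew hx,
        show planeAngle e w x = π from harg]
    · rw [← norm_ne_zero_iff, norm_inner_mk_inner hew, norm_ne_zero_iff]
      exact hx.1
  have hcoord : Continuous fun x : Euc 2 => (⟨⟪x, e⟫_ℝ, ⟪x, w⟫_ℝ⟩ : ℂ) :=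
    Complex.equivRealProdCLM.symm.continuous.comp
      (f := fun x : Euc 2 => (⟪x, e⟫_ℝ, ⟪x, w⟫_ℝ)) (by fun_prop)
  exact (ContinuousAt.comp (f := fun x : Euc 2 => (⟨⟪x, e⟫_ℝ, ⟪x, w⟫_ℝ⟩ : ℂ))
    (Complex.continuousAt_arg hslit) hcoord.continuousAt).continuousWithinAt

end PlaneAngle

section PolarDomain

variable {α : ℝ} {h : ℝ → ℝ}

theorem orthonormal_polarPoint (β : ℝ) :
    Orthonormal ℝ ![polarPoint 1 β, polarPoint 1 (β + π / 2)] := by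
  have hnorm (θ : ℝ) : ‖polarPoint 1 θ‖ = 1 := by
    rw [← pow_eq_one_iff_of_nonneg (norm_nonneg _) two_ne_zero, EuclideanSpace.norm_sq_eq]
    simp [polarPoint]
  have hinner : ⟪polarPoint 1 β, polarPoint 1 (β + π / 2)⟫_ℝ = 0 := by
    simp [polarPoint, PiLp.inner_apply, Real.cos_add_pi_div_two, Real.sin_add_pi_div_two]
    ring
  simp [orthonormal_vecCons_iff, hnorm, hinner]

theorem polarPoint_eq_smul_planeDirection (β r θ : ℝ) :
    polarPoint r θ =
      r • planeDirection (polarPoint 1 β) (polarPoint 1 (β + π / 2)) (θ - β) := by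
  have hcos := Real.cos_add (θ - β) β
  have hsin := Real.sin_add (θ - β) β
  rw [sub_add_cancel] at hcos hsin
  ext i
  fin_cases i
  · simp only [polarPoint, planeDirection, hcos, Real.cos_add_pi_div_two, one_mul, smul_add,
      PiLp.add_apply, PiLp.smul_apply, smul_eq_mul, Fin.zero_eta, PiLp.toLp_apply,
      Matrix.cons_val_zero]
    ring
  · simp only [polarPoint, planeDirection, hsin, Real.sin_add_pi_div_two, one_mul, smul_add,
      PiLp.add_apply, PiLp.smul_apply, smul_eq_mul, Fin.mk_one, PiLp.toLp_apply,
      Matrix.cons_val_one, Matrix.cons_val_fin_one]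
    ring

/-- The polar angle of the standard coordinates, with values in `(α / 2 - π, α / 2 + π]`. -/
noncomputable def sectorAngle (α : ℝ) (x : Euc 2) : ℝ :=
  planeAngle (polarPoint 1 (α / 2)) (polarPoint 1 (α / 2 + π / 2)) x + α / 2

theorem polarPoint_norm_sectorAngle (α : ℝ) (x : Euc 2) : polarPoint ‖x‖ (sectorAngle α x) = x := by
  rw [polarPoint_eq_smul_planeDirection (α / 2), sectorAngle, add_sub_cancel_right,
    norm_smul_planeDirection_planeAngle (orthonormal_polarPoint _)]

theorem sectorAngle_mem_Ioo {x : Euc 2} (hx : x ∈ openCone 0 (polarPoint 1 (α / 2)) α) :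
    sectorAngle α x ∈ Ioo 0 α := by
  obtain ⟨hneg, hpos⟩ := abs_lt.1 (abs_planeAngle_lt (orthonormal_polarPoint _) hx)
  exact ⟨neg_lt_iff_pos_add.1 hneg, lt_sub_iff_add_lt.1 (hpos.trans_eq (sub_half α).symm)⟩

theorem polarPoint_mem_openCone_and_sectorAngle_eq (hα : α ≤ 2 * π) {r θ : ℝ} (hr : 0 < r)
    (hθ : θ ∈ Ioo 0 α) :
    polarPoint r θ ∈ openCone 0 (polarPoint 1 (α / 2)) α ∧ sectorAngle α (polarPoint r θ) = θ := by
  have hew := orthonormal_polarPoint (α / 2)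
  have habs : |θ - α / 2| < α / 2 := abs_lt.2 ⟨by linarith [hθ.1], by linarith [hθ.2]⟩
  have hπ : |θ - α / 2| < π := by linarith
  rw [polarPoint_eq_smul_planeDirection (α / 2) r]
  constructor
  · rw [← zero_add (r • _)]
    exact (add_smul_planeDirection_mem_openCone_iff hew hr hπ.le).2 habs
  · rw [sectorAngle, planeAngle_smul_planeDirection hew hr (Ioo_subset_Ioc_self (abs_lt.1 hπ)),
      sub_add_cancel]

theorem norm_polarPoint {r : ℝ} (hr : 0 ≤ r) (θ : ℝ) : ‖polarPoint r θ‖ = r := by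
  rw [polarPoint_eq_smul_planeDirection 0, norm_smul_planeDirection (orthonormal_polarPoint 0) hr]

theorem polarDomain_eq_sep_openCone (hα : α ≤ 2 * π) (h : ℝ → ℝ) :
    polarDomain α h =
      {x ∈ openCone 0 (polarPoint 1 (α / 2)) α | ‖x‖ < h (sectorAngle α x)} := by
  ext x
  constructor
  · rintro ⟨r, θ, hθ, hθα, hr, hrh, rfl⟩
    obtain ⟨hcone, hangle⟩ := polarPoint_mem_openCone_and_sectorAngle_eq hα hr ⟨hθ, hθα⟩
    exact ⟨hcone, by rwa [hangle, norm_polarPoint hr.le]⟩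
  · rintro ⟨hx, hlt⟩
    obtain ⟨hpos, hlt_α⟩ := sectorAngle_mem_Ioo hx
    exact ⟨‖x‖, sectorAngle α x, hpos, hlt_α, norm_pos_iff.2 hx.1, hlt,
      (polarPoint_norm_sectorAngle α x).symm⟩

theorem isConicalRegion_polarDomain (hα : α ∈ Ioc 0 (2 * π)) (hh : ContinuousOn h (Ioo 0 α))
    (hbdd : BddAbove (h '' Ioo 0 α)) :
    IsConicalRegion 0 (polarPoint 1 (α / 2)) α (polarDomain α h) (polarGraph α h) := by
  have hangle : MapsTo (sectorAngle α) (openCone 0 (polarPoint 1 (α / 2)) α) (Ioo 0 α) :=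
    fun _ => sectorAngle_mem_Ioo
  have hcont : ContinuousOn (sectorAngle α) (openCone 0 (polarPoint 1 (α / 2)) α) :=
    (continuousOn_planeAngle (orthonormal_polarPoint _) hα.2).add continuousOn_const
  rw [polarDomain_eq_sep_openCone hα.2]
  refine isConicalRegion_sep_norm_lt ((orthonormal_polarPoint (α / 2)).ne_zero 0) hα
    (hh.comp hcont hangle) (hbdd.mono ?_) fun x hx => ?_
  · rw [image_comp]
    exact image_mono hangle.image_subset
  · obtain ⟨hpos, hlt⟩ := sectorAngle_mem_Ioo hx.1
    have hnorm : ‖x‖ = h (sectorAngle α x) := hx.2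
    exact ⟨sectorAngle α x, hpos, hlt, by rw [← hnorm, polarPoint_norm_sectorAngle]⟩

end PolarDomain

theorem IsConicalDomain.isConicalRegion {n : ℕ} {v u : Euc n} {α : ℝ} {Ω E : Set (Euc n)}
    (h : IsConicalDomain v u α Ω E) (hu : u ≠ 0) (hα : α ∈ Ioc 0 (2 * π)) :
    IsConicalRegion v u α Ω E where
  ne_zero := hu
  pos := hα.1
  le_two_mul_pi := hα.2
  isOpen := h.isOpen
  isBounded := h.isBounded
  subset_cone := h.subset_cone
  frontier_diff_subset := h.frontier_diff_subset

theorem pi_div_mem_Ioc {m : ℝ} (hm : 1 / 2 ≤ m) : π / m ∈ Ioc 0 (2 * π) := by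
  have hm0 : 0 < m := one_half_pos.trans_le hm
  refine ⟨by positivity, (div_le_iff₀ hm0).2 ?_⟩
  nlinarith [Real.pi_pos]

end BrokenRayTransform

theorem proposition2p2_general {n : ℕ} (hn : 2 ≤ n) {v u : Euc n} {α : ℝ} {Ω E : Set (Euc n)}
    (h : IsConicalRegion v u α Ω E) : BrtInjectiveWithSubdomains Ω E :=
  ⟨h.brtInjective hn, fun _ hΩ' _ hsub => (h.subregion hΩ' hsub).brtInjective hn⟩

theorem proposition2p2 :
    -- (1) planar cones of opening angle `π / m`, `m` a positive integer
    (∀ m : ℕ, 1 ≤ m →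
      (∀ (v u : Euc 2) (Ω E : Set (Euc 2)), u ≠ 0 → IsConicalDomain v u (Real.pi / m) Ω E →
        BrtInjectiveWithSubdomains Ω E) ∧
      (∀ h : ℝ → ℝ, ContinuousOn h (Set.Ioo 0 (Real.pi / m)) →
        (∀ θ ∈ Set.Ioo 0 (Real.pi / m), 0 < h θ) → BddAbove (h '' Set.Ioo 0 (Real.pi / m)) →
        BrtInjectiveWithSubdomains (polarDomain (Real.pi / m) h) (polarGraph (Real.pi / m) h))) ∧
    -- (2) planar cones of any opening angle `π / m` in `(0, 2π]`
    (∀ m : ℝ, 1 / 2 ≤ m →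
      (∀ (v u : Euc 2) (Ω E : Set (Euc 2)), u ≠ 0 → IsConicalDomain v u (Real.pi / m) Ω E →
        BrtInjectiveWithSubdomains Ω E) ∧
      (∀ h : ℝ → ℝ, ContinuousOn h (Set.Ioo 0 (Real.pi / m)) →
        (∀ θ ∈ Set.Ioo 0 (Real.pi / m), 0 < h θ) → BddAbove (h '' Set.Ioo 0 (Real.pi / m)) →
        BrtInjectiveWithSubdomains (polarDomain (Real.pi / m) h) (polarGraph (Real.pi / m) h))) ∧
    -- (3) cones `|x'| < k x` in dimension `d + 1 ≥ 2` with `π / (2 arctan k)` an integer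
    (∀ d : ℕ, 1 ≤ d → ∀ k : ℝ, 0 < k → (∃ m : ℕ, Real.pi / (2 * Real.arctan k) = m) →
      ∀ h : Euc (d + 1) → ℝ, ContinuousOn h (Metric.sphere 0 1) →
        (∀ ω ∈ Metric.sphere (0 : Euc (d + 1)) 1, 0 < h ω) →
        BrtInjectiveWithSubdomains
          (radialDomain (slopeCone d k) h) (radialGraph (slopeCone d k) h)) ∧
    -- (4) the same for all `k`, and for circular cones of any opening angle in `(0, 2π]`
    (∀ d : ℕ, 1 ≤ d → ∀ k : ℝ,
      ∀ h : Euc (d + 1) → ℝ, ContinuousOn h (Metric.sphere 0 1) →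
        (∀ ω ∈ Metric.sphere (0 : Euc (d + 1)) 1, 0 < h ω) →
        BrtInjectiveWithSubdomains
          (radialDomain (slopeCone d k) h) (radialGraph (slopeCone d k) h)) ∧
    (∀ n : ℕ, 2 ≤ n → ∀ α : ℝ, 0 < α → α ≤ 2 * Real.pi → ∀ u : Euc n, u ≠ 0 →
      (∀ h : Euc n → ℝ, ContinuousOn h (Metric.sphere 0 1) →
        (∀ ω ∈ Metric.sphere (0 : Euc n) 1, 0 < h ω) →
        BrtInjectiveWithSubdomains
          (radialDomain (openCone 0 u α) h) (radialGraph (openCone 0 u α) h)) ∧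
      (∀ (v : Euc n) (Ω E : Set (Euc n)), IsConicalDomain v u α Ω E →
        BrtInjectiveWithSubdomains Ω E)) := by
  have hplane {α : ℝ} (hα : α ∈ Ioc 0 (2 * Real.pi)) :
      (∀ (v u : Euc 2) (Ω E : Set (Euc 2)), u ≠ 0 → IsConicalDomain v u α Ω E →
        BrtInjectiveWithSubdomains Ω E) ∧
      ∀ h : ℝ → ℝ, ContinuousOn h (Ioo 0 α) → (∀ θ ∈ Ioo 0 α, 0 < h θ) →
        BddAbove (h '' Ioo 0 α) →
        BrtInjectiveWithSubdomains (polarDomain α h) (polarGraph α h) :=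
    ⟨fun _ _ _ _ hu h => proposition2p2_general le_rfl (h.isConicalRegion hu hα),
      fun _ hh _ hbdd => proposition2p2_general le_rfl (isConicalRegion_polarDomain hα hh hbdd)⟩
  have hslope (d : ℕ) (hd : 1 ≤ d) (k : ℝ) (h : Euc (d + 1) → ℝ)
      (hh : ContinuousOn h (Metric.sphere 0 1)) : BrtInjectiveWithSubdomains
        (radialDomain (slopeCone d k) h) (radialGraph (slopeCone d k) h) :=
    have ⟨_, _, hregion⟩ := exists_isConicalRegion_slopeCone d k hh
    proposition2p2_general (Nat.succ_le_succ hd) hregion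
  have hhalf (m : ℕ) (hm : 1 ≤ m) : (1 / 2 : ℝ) ≤ m :=
    one_half_lt_one.le.trans (Nat.one_le_cast.2 hm)
  exact ⟨fun m hm => hplane (pi_div_mem_Ioc (hhalf m hm)), fun m hm => hplane (pi_div_mem_Ioc hm),
    fun d hd k _ _ h hh _ => hslope d hd k h hh, fun d hd k h hh _ => hslope d hd k h hh,
    fun n hn α hα hα' u hu =>
      ⟨fun h hh _ => proposition2p2_general hn (isConicalRegion_radialDomain hu ⟨hα, hα'⟩ hh),
        fun v Ω E h => proposition2p2_general hn (h.isConicalRegion hu ⟨hα, hα'⟩)⟩⟩
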